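/- Let $s,r,\ell$ be positive integers with $\gcd(s,\ell)=1$ and let $a,b>0$. For $\lambda>0$, $h\in\mathbb{R}$ and $j=1,\dots,s$ put $$Z_{\lambda,j}(h)=\lambda a\cos\Big(\frac{rh+2\pi(j-1)}{s}\Big)+\mathrm{i}\,\frac{\lambda b}{\ell}\sin\Big(\ell\,\frac{rh+2\pi(j-1)}{s}\Big),\qquad p_\lambda(u,h)=\prod_{j=1}^{s}\big(u-Z_{\lambda,j}(h)\big).$$ Multiplied out, $p_\lambda$ is a polynomial in $u$, $\mathrm{e}^{\mathrm{i}h}$ and $\mathrm{e}^{-\mathrm{i}h}$ without terms containing both $\mathrm{e}^{\mathrm{i}h}$ and $\mathrm{e}^{-\mathrm{i}h}$; let $f_\lambda(u,v)$ be the function on $\mathbb{C}^2$ obtained by writing $v$ for $\mathrm{e}^{\mathrm{i}h}$ and $\overline v$ for $\mathrm{e}^{-\mathrm{i}h}$. Let $S^3=\{(u,v)\in\mathbb{C}^2:|u|^2+|v|^2=1\}$ and $K_\lambda=f_\lambda^{-1}(0)\cap S^3$. A phase-critical point of a smooth complex-valued function is a point at which the function is nonzero and the gradient of its argument vanishes.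 The condition that $p_\lambda$ has no phase-critical points in $\mathbb{C}\times[0,2\pi]$ holds for one $\lambda>0$ if and only if it holds for all $\lambda>0$. If it holds, then there is $\varepsilon>0$ such that for all $\lambda\in(0,\varepsilon)$: (i) $K_\lambda$ is ambient isotopic in $S^3$ to the lemniscate knot or link $L(s,r,\ell)$, that is, to the closed braid $\{(Z_{\lambda,j}(h),\sqrt{1-|Z_{\lambda,j}(h)|^2}\,\mathrm{e}^{\mathrm{i}h}):1\le j\le s,\ 0\le h\le 2\pi\}$; (ii) $\nabla_{S^3}\arg(f_\lambda)\ne0$ at every point of $S^3\setminus K_\lambda$; (iii) $\arg(f_\lambda):S^3\setminus K_\lambda\to S^1$ is a locally trivial fibration. -/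

import Mathlib

open scoped LaurentPolynomial ComplexConjugate

noncomputable section

namespace Lemniscate

/-! ### The lemniscate braid and its polynomial -/

/-- The `j`-th strand `Z_j(h) = X_j(h) + i Y_j(h)` of the lemniscate braid with `s` strands, `r`
repeats and `ℓ` lobes, with stretching factors `a`, `b`:
`X_j(h) = a cos((r h + 2π j)/s)` and `Y_j(h) = (b/ℓ) sin(ℓ (r h + 2π j)/s)`.
Strands are numbered `j = 0, …, s - 1`. -/
def strand (a b : ℝ) (s r ℓ : ℕ) (j : ℕ) (h : ℝ) : ℂ :=
  ((a * Real.cos ((r * h + 2 * Real.pi * j) / s) : ℝ) : ℂ)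
    + ((b / ℓ * Real.sin (ℓ * ((r * h + 2 * Real.pi * j) / s)) : ℝ) : ℂ) * Complex.I

/-- The braid polynomial `p(u, h) = ∏_j (u - Z_j(h))`. -/
def braidPoly (a b : ℝ) (s r ℓ : ℕ) (x : ℂ × ℝ) : ℂ :=
  ∏ j ∈ Finset.range s, (x.1 - strand a b s r ℓ j x.2)

/-! ### The semiholomorphic map `f(u, v, v̄)` -/

/-- The `j`-th strand as a Laurent polynomial in `T = exp(i r h / s)`. -/
def strandLaurent (a b : ℝ) (s ℓ : ℕ) (j : ℕ) : ℂ[T;T⁻¹] :=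
  LaurentPolynomial.C ((a / 2 : ℂ) * Complex.exp (2 * Real.pi * Complex.I * j / s))
      * LaurentPolynomial.T 1
    + LaurentPolynomial.C ((a / 2 : ℂ) * Complex.exp (-(2 * Real.pi * Complex.I * j / s)))
      * LaurentPolynomial.T (-1)
    + LaurentPolynomial.C ((b / (2 * ℓ) : ℂ) * Complex.exp (ℓ * (2 * Real.pi * Complex.I * j / s)))
      * LaurentPolynomial.T (ℓ : ℤ)
    - LaurentPolynomial.C
        ((b / (2 * ℓ) : ℂ) * Complex.exp (-(ℓ * (2 * Real.pi * Complex.I * j / s))))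
      * LaurentPolynomial.T (-(ℓ : ℤ))

/-- The braid polynomial multiplied out, as a polynomial in `u` whose coefficients are Laurent
polynomials in `T = exp(i r h / s)`. -/
def braidLaurent (a b : ℝ) (s ℓ : ℕ) : Polynomial ℂ[T;T⁻¹] :=
  ∏ j ∈ Finset.range s, (Polynomial.X - Polynomial.C (strandLaurent a b s ℓ j))

/-- What `exp(i n h)` is replaced by: `v ^ n` if `n ≥ 0` and `v̄ ^ (-n)` if `n < 0`. -/
def conjPow (v : ℂ) (n : ℤ) : ℂ :=
  if 0 ≤ n then v ^ n.toNat else (conj v) ^ (-n).toNat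

/-- The map `f(u, v, v̄)`, as a function of `(u, v)`: the braid polynomial is multiplied out, and
`v` is written for `exp(i h)` and `v̄` for `exp(-i h)`, so that there are no mixed terms `v v̄`.
A power `T ^ m = exp(i r h m / s)` occurs only if `s ∣ m` (`coeff_braidLaurent_eq_zero`), and then
it is `exp(i n h)` with `n = r * (m / s)`. -/
def semiholMap (a b : ℝ) (s r ℓ : ℕ) (q : ℂ × ℂ) : ℂ :=
  (braidLaurent a b s ℓ).sum fun k c =>
    (c.coeff.sum fun m z => z * conjPow q.2 (r * (m / s))) * q.1 ^ k

/-! ### The phase and its critical points -/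

/-- The differential at `x` of the (locally defined) argument of `g`, where `g x ≠ 0`. The local
branch is normalised to vanish at `x`. -/
def dArg {E : Type*} [NormedAddCommGroup E] [NormedSpace ℝ E] (g : E → ℂ) (x : E) : E →L[ℝ] ℝ :=
  fderiv ℝ (fun y => Complex.arg (g y / g x)) x

/-- `x` is a phase-critical point of `g`: the argument is defined there and has zero gradient. -/
def IsPhaseCritical {E : Type*} [NormedAddCommGroup E] [NormedSpace ℝ E] (g : E → ℂ) (x : E) :
    Prop :=
  g x ≠ 0 ∧ dArg g x = 0

/-- The braid polynomial has no phase-critical points in `ℂ × [0, 2π]`. -/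
def NoPhaseCritical (a b : ℝ) (s r ℓ : ℕ) : Prop :=
  ∀ u : ℂ, ∀ h ∈ Set.Icc (0 : ℝ) (2 * Real.pi), ¬ IsPhaseCritical (braidPoly a b s r ℓ) (u, h)

/-- The unit three-sphere in `ℂ²`. -/
def S3 : Set (ℂ × ℂ) := {q | ‖q.1‖ ^ 2 + ‖q.2‖ ^ 2 = 1}

/-- `q ∈ S³` is a critical point of the restriction of `arg g` to `S³`: the differential of
`arg g` vanishes on the tangent space of `S³` at `q`, the real orthogonal complement of `q`. -/
def IsPhaseCriticalOnS3 (g : ℂ × ℂ → ℂ) (q : ℂ × ℂ) : Prop :=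
  q ∈ S3 ∧ g q ≠ 0 ∧
    ∀ w : ℂ × ℂ, inner ℝ q.1 w.1 + inner ℝ q.2 w.2 = 0 → dArg g q w = 0

/-! ### The knot and the fibration -/

/-- The nodal set of `g` on `S³`. -/
def nodalSet (g : ℂ × ℂ → ℂ) : Set S3 := {q | g q = 0}

/-- `arg g` as a map from the complement of the nodal set in `S³` to the circle. -/
def phaseMap (g : ℂ × ℂ → ℂ) (q : ((nodalSet g)ᶜ : Set S3)) : Circle :=
  Circle.exp (Complex.arg (g (q : S3)))

/-- A map is a (locally trivial) fibration with some nonempty typical fibre. -/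
def IsLocallyTrivialFibration {Z B : Type} [TopologicalSpace Z] [TopologicalSpace B]
    (π : Z → B) : Prop :=
  ∃ (F : Type) (_ : TopologicalSpace F), Nonempty F ∧
    ∀ x : B, ∃ e : Bundle.Trivialization F π, x ∈ e.baseSet

/-- The closure in `S³` of the lemniscate braid, the lemniscate knot or link `L(s, r, ℓ)`: the
image of the strands under `(u, exp(i h)) ↦ (u, √(1 - |u|²) exp(i h))`
(meant for `a`, `b` so small that the strands lie in the unit disc). -/
def lemniscateLink (a b : ℝ) (s r ℓ : ℕ) : Set S3 :=
  {q | ∃ j ∈ Finset.range s, ∃ h ∈ Set.Icc (0 : ℝ) (2 * Real.pi),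
    (q : ℂ × ℂ).1 = strand a b s r ℓ j h ∧
    (q : ℂ × ℂ).2 = (Real.sqrt (1 - ‖strand a b s r ℓ j h‖ ^ 2) : ℂ) * Complex.exp (h * Complex.I)}

/-- Two subsets of a space are ambient isotopic. -/
def AmbientIsotopic {X : Type*} [TopologicalSpace X] (K L : Set X) : Prop :=
  ∃ H : unitInterval → X ≃ₜ X,
    Continuous (fun x : unitInterval × X => H x.1 x.2) ∧ (∀ x, H 0 x = x) ∧ H 1 '' K = L

/-! ### The map `f` extends the braid polynomial -/

/-- The substitution `T ↦ exp(2π i / s) T`. -/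
def rot (s : ℕ) : ℂ[T;T⁻¹] →+* ℂ[T;T⁻¹] :=
  LaurentPolynomial.eval₂ LaurentPolynomial.C
    (Units.mk (LaurentPolynomial.C (Complex.exp (2 * Real.pi * Complex.I / s))
        * LaurentPolynomial.T 1)
      (LaurentPolynomial.C (Complex.exp (-(2 * Real.pi * Complex.I / s)))
        * LaurentPolynomial.T (-1))
      (by
        rw [mul_mul_mul_comm, ← map_mul, ← LaurentPolynomial.T_add, ← Complex.exp_add]; simp)
      (by
        rw [mul_mul_mul_comm, ← map_mul, ← LaurentPolynomial.T_add, ← Complex.exp_add]; simp))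

theorem rot_C_mul_T (s : ℕ) (z : ℂ) (n : ℤ) :
    rot s (LaurentPolynomial.C z * LaurentPolynomial.T n)
      = LaurentPolynomial.C (z * Complex.exp (n * (2 * Real.pi * Complex.I / s)))
        * LaurentPolynomial.T n := by
  rw [rot, LaurentPolynomial.eval₂_C_mul_T, map_mul, mul_assoc (LaurentPolynomial.C z)]
  refine congrArg (LaurentPolynomial.C z * ·) ?_
  obtain ⟨k, rfl | rfl⟩ := n.eq_nat_or_neg
  · rw [zpow_natCast, Units.val_pow_eq_pow_val, mul_pow, ← map_pow, LaurentPolynomial.T_pow,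
      ← Complex.exp_nat_mul]
    simp
  · rw [zpow_neg, zpow_natCast, ← inv_pow, Units.val_pow_eq_pow_val, Units.inv_mk,
      mul_pow, ← map_pow, LaurentPolynomial.T_pow, ← Complex.exp_nat_mul]
    simp

theorem coeff_rot (s : ℕ) (c : ℂ[T;T⁻¹]) (m : ℤ) :
    (rot s c).coeff m = c.coeff m * Complex.exp (m * (2 * Real.pi * Complex.I / s)) := by
  induction c using LaurentPolynomial.induction_on' with
  | add p q hp hq => simp [hp, hq, add_mul]
  | C_mul_T n z =>
    rw [rot_C_mul_T, ← LaurentPolynomial.single_eq_C_mul_T, ← LaurentPolynomial.single_eq_C_mul_T,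
      AddMonoidAlgebra.coeff_single, AddMonoidAlgebra.coeff_single, Finsupp.single_apply,
      Finsupp.single_apply]
    split_ifs with h
    · rw [h]
    · rw [zero_mul]

theorem rot_strandLaurent (a b : ℝ) (s ℓ j : ℕ) :
    rot s (strandLaurent a b s ℓ j) = strandLaurent a b s ℓ (j + 1) := by
  simp only [strandLaurent, map_add, map_sub, rot_C_mul_T, mul_assoc, ← Complex.exp_add]
  congr 6 <;> (push_cast; ring_nf)

theorem strandLaurent_period (a b : ℝ) (s ℓ : ℕ) (hs : 0 < s) :
    strandLaurent a b s ℓ s = strandLaurent a b s ℓ 0 := by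
  have hs' : (s : ℂ) ≠ 0 := by exact_mod_cast hs.ne'
  have h1 : Complex.exp (2 * Real.pi * Complex.I) = 1 := Complex.exp_two_pi_mul_I
  have h2 : Complex.exp (ℓ * (2 * Real.pi * Complex.I)) = 1 := Complex.exp_nat_mul_two_pi_mul_I ℓ
  simp [strandLaurent, mul_div_assoc, div_self hs', Complex.exp_neg, h1, h2]

theorem map_rot_braidLaurent (a b : ℝ) (s ℓ : ℕ) :
    (braidLaurent a b s ℓ).map (rot s) = braidLaurent a b s ℓ := by
  rcases s.eq_zero_or_pos with rfl | hs
  · simp [braidLaurent]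
  obtain ⟨n, rfl⟩ := Nat.exists_eq_succ_of_ne_zero hs.ne'
  simp only [braidLaurent, Polynomial.map_prod, Polynomial.map_sub, Polynomial.map_X,
    Polynomial.map_C, rot_strandLaurent]
  rw [Finset.prod_range_succ, Finset.prod_range_succ']
  rw [show n + 1 = n.succ from rfl, strandLaurent_period a b n.succ ℓ hs]

/-- Only powers `T ^ m` with `s ∣ m` occur in the braid polynomial. -/
theorem coeff_braidLaurent_eq_zero (a b : ℝ) (s ℓ : ℕ) (hs : 0 < s) (k : ℕ) (m : ℤ)
    (hm : ¬ (s : ℤ) ∣ m) : ((braidLaurent a b s ℓ).coeff k).coeff m = 0 := by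
  have h := congrArg (fun P => (P.coeff k).coeff m) (map_rot_braidLaurent a b s ℓ)
  simp only [Polynomial.coeff_map, coeff_rot] at h
  by_contra h0
  have h1 : Complex.exp (m * (2 * Real.pi * Complex.I / s)) = 1 :=
    mul_left_cancel₀ h0 (by rw [h, mul_one])
  obtain ⟨n, hn⟩ := Complex.exp_eq_one_iff.mp h1
  apply hm
  refine ⟨n, ?_⟩
  have hs' : (s : ℂ) ≠ 0 := by exact_mod_cast hs.ne'
  have h2 : (m : ℂ) = s * n := by
    have := Complex.two_pi_I_ne_zero
    field_simp at hn
    exact hn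
  exact_mod_cast h2

theorem conjPow_exp (h : ℝ) (n : ℤ) :
    conjPow (Complex.exp (h * Complex.I)) n = Complex.exp (n * (h * Complex.I)) := by
  unfold conjPow
  split_ifs with hn
  · obtain ⟨k, rfl⟩ := Int.eq_ofNat_of_zero_le hn
    simp [← Complex.exp_nat_mul]
  · obtain ⟨k, hk⟩ := Int.eq_ofNat_of_zero_le (by omega : 0 ≤ -n)
    obtain rfl : n = -(k : ℤ) := by omega
    rw [← Complex.exp_conj, ← Complex.exp_nat_mul]
    simp

/-- On `ℂ × S¹` the map `f` is the braid polynomial: `f(u, exp(i h)) = p(u, h)`. -/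
theorem semiholMap_exp (a b : ℝ) (s r ℓ : ℕ) (hs : 0 < s) (u : ℂ) (h : ℝ) :
    semiholMap a b s r ℓ (u, Complex.exp (h * Complex.I)) = braidPoly a b s r ℓ (u, h) := by
  have hs' : (s : ℂ) ≠ 0 := by exact_mod_cast hs.ne'
  set t : ℂˣ := Units.mk0 (Complex.exp (r * h * Complex.I / s)) (Complex.exp_ne_zero _) with ht
  set φ : ℂ[T;T⁻¹] →+* ℂ := LaurentPolynomial.eval₂ (RingHom.id ℂ) t with hφ
  have htz : ∀ n : ℤ, ((t ^ n : ℂˣ) : ℂ) = Complex.exp (n * (r * h * Complex.I / s)) := by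
    intro n
    rw [Units.val_zpow_eq_zpow_val, ht, Units.val_mk0, ← Complex.exp_int_mul]
  have hstrand : ∀ j, φ (strandLaurent a b s ℓ j) = strand a b s r ℓ j h := by
    intro j
    simp only [strandLaurent, strand, map_add, map_sub, hφ, LaurentPolynomial.eval₂_C_mul_T, htz,
      RingHom.id_apply, mul_assoc, ← Complex.exp_add]
    push_cast
    rw [Complex.cos, Complex.sin]
    have e1 : ∀ x y : ℂ, x = y → Complex.exp x = Complex.exp y := fun x y hxy => by rw [hxy]
    rw [e1 (((r : ℂ) * h + 2 * (Real.pi * j)) / s * Complex.I)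
        (2 * (Real.pi * (Complex.I * j)) / s + 1 * (r * (h * Complex.I) / s)) (by ring),
      e1 (-(((r : ℂ) * h + 2 * (Real.pi * j)) / s) * Complex.I)
        (-(2 * (Real.pi * (Complex.I * j)) / s) + -1 * (r * (h * Complex.I) / s)) (by ring),
      e1 ((ℓ : ℂ) * ((r * h + 2 * (Real.pi * j)) / s) * Complex.I)
        (ℓ * (2 * (Real.pi * (Complex.I * j)) / s) + ℓ * (r * (h * Complex.I) / s)) (by ring),
      e1 (-((ℓ : ℂ) * ((r * h + 2 * (Real.pi * j)) / s)) * Complex.I)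
        (-(ℓ * (2 * (Real.pi * (Complex.I * j)) / s)) + -ℓ * (r * (h * Complex.I) / s)) (by ring)]
    linear_combination (-(b : ℂ) / ℓ / 2 *
      (Complex.exp (-(ℓ * (2 * (Real.pi * (Complex.I * j)) / s)) + -ℓ * (r * (h * Complex.I) / s))
      - Complex.exp (ℓ * (2 * (Real.pi * (Complex.I * j)) / s) + ℓ * (r * (h * Complex.I) / s))))
      * Complex.I_mul_I
  have hcoeff : ∀ k, (((braidLaurent a b s ℓ).coeff k).coeff.sum fun m z =>
      z * conjPow (Complex.exp (h * Complex.I)) (r * (m / s)))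
        = φ ((braidLaurent a b s ℓ).coeff k) := by
    intro k
    set c := (braidLaurent a b s ℓ).coeff k with hc
    have h1 : φ c = c.coeff.sum fun m z => z * ((t ^ m : ℂˣ) : ℂ) := by
      have h2 : ∀ d : ℂ[T;T⁻¹], φ d = d.coeff.sum fun m z => z * ((t ^ m : ℂˣ) : ℂ) := by
        intro d
        induction d using LaurentPolynomial.induction_on' with
        | add p q hp hq =>
          rw [map_add, hp, hq, AddMonoidAlgebra.coeff_add, Finsupp.sum_add_index'] <;> intros <;> ring
        | C_mul_T n z =>
          rw [hφ, LaurentPolynomial.eval₂_C_mul_T, ← LaurentPolynomial.single_eq_C_mul_T,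
            AddMonoidAlgebra.coeff_single, Finsupp.sum_single_index (zero_mul _), RingHom.id_apply]
      exact h2 c
    rw [h1]
    refine Finset.sum_congr rfl fun m _ => ?_
    by_cases hm : (s : ℤ) ∣ m
    · obtain ⟨n, rfl⟩ := hm
      have hs0 : (s : ℤ) ≠ 0 := by exact_mod_cast hs.ne'
      beta_reduce
      rw [Int.mul_ediv_cancel_left _ hs0, conjPow_exp, htz]
      congr 2
      push_cast
      field_simp
    · simp [hc, coeff_braidLaurent_eq_zero a b s ℓ hs k m hm]
  calc semiholMap a b s r ℓ (u, Complex.exp (h * Complex.I))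
      = (braidLaurent a b s ℓ).sum fun k c => φ c * u ^ k := by
        rw [semiholMap, Polynomial.sum, Polynomial.sum]
        exact Finset.sum_congr rfl fun k _ => by rw [hcoeff k]
    _ = (braidLaurent a b s ℓ).eval₂ φ u := by rw [Polynomial.eval₂_eq_sum]
    _ = braidPoly a b s r ℓ (u, h) := by
        simp [braidLaurent, braidPoly, Polynomial.eval₂_finsetProd, hstrand]

end Lemniscate

end

/-!
Write `f_λ` for the map `semiholMap (λ a) (λ b) s r ℓ` and `g` for `f_1`. The coefficients of the
polynomial `g(·, v)` are real-smooth in `v`, its leading term is `u ^ s`, and multiplying out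
commutes with rescaling: `f_λ(λ w, v) = λ ^ s g(w, v)` (`semiholMap_smul`). So everything about `f_λ`
on `S³` is a statement about `g` on the ellipsoids `λ²|w|² + |v|² = 1`, whose bounded parts converge
to `ℂ × S¹` as `λ → 0`. On `ℂ × S¹` the map `g` is the braid polynomial, whose roots in `w` are the
strands; they are simple because `s` and `ℓ` are coprime (`strand_ne`).

**Critical points.** For `|w| ≥ M` the term `w ^ s` dominates, so that the phase of `g` increases along
the circles `(e^{iτ} w, v)`, which lie in the ellipsoids (`exists_re_mul_semiholDeriv_pos`). For
`|w| ≤ M` a sequence of critical points with `λ → 0` would have a limit `(w, v)` with `|v| = 1` at which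
`∂g/∂w = 0`; since roots are simple this is not a zero of `g`, hence it is a phase-critical point of the
braid polynomial (`exists_phaseRegular_rescaled`). The argument is run for pairs of a point and a
phase, where at a zero of `g` every phase is admitted. It then also shows that `f_λ` is a submersion
on `S³` along its nodal set; the two facts together are `IsPhaseRegularOnS3`.

**Fibration.** Let `T` be the tangential gradient of the phase of `F = f_λ`, times `|F|²`. By
regularity and compactness `c |F| ≤ |T|` on `S³`, so the field `|F|² T / |T|²`, which advances the phase
at unit speed, extends to a Lipschitz field on `S³` that vanishes on the nodal set
(`exists_lipschitzOnWith_sq_div_smul`). Its flow exists for all times, fixes the nodal set and covers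
the rotation of the circle, and such a flow trivialises the phase map over every arc
(`isLocallyTrivialFibration_of_flow`).

**Isotopy.** In the coordinates `(w, h)` of a neighbourhood of the circle `u = 0`, `v = e^{ih}`, the
nodal set of `f_λ` is given by `G_λ(w, h) = g(w, √(1 - λ²|w|²) e^{ih}) = 0`, a small perturbation of
`g(w, e^{ih}) = 0`. Near a root `z` the map `w ↦ z + G_λ(w, h) / ∂g/∂w(z, e^{ih})` is `C¹`-close to the
identity and takes the zero of `G_λ` to `z`. Cutting its displacement off outside disjoint balls gives
for each angle `h` a perturbation of the identity of `ℂ` by a contraction, and scaling the displacement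
by `t ∈ [0, 1]` gives an ambient isotopy from the nodal set to the lemniscate link
(`exists_displacement`, `ambientIsotopic_of_pageMove`). The zeros of `G_λ` need not be parametrised.
-/

open scoped NNReal Topology ComplexConjugate LaurentPolynomial

noncomputable section

/-! ### Flows of Lipschitz vector fields -/

/-- A bounded, globally Lipschitz vector field on a Banach space has a global flow. Boundedness
makes the Picard–Lindelöf theorem applicable on time intervals of any length. -/
theorem LipschitzWith.exists_continuous_flow {E : Type*} [NormedAddCommGroup E] [NormedSpace ℝ E]
    [CompleteSpace E] {X : E → E} {K L : ℝ≥0} (hX : LipschitzWith K X) (hL : ∀ x, ‖X x‖ ≤ L) :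
    ∃ φ : ℝ → E → E, (∀ x, φ 0 x = x) ∧ (∀ x t, HasDerivAt (fun t => φ t x) (X (φ t x)) t) ∧
      Continuous (fun p : ℝ × E => φ p.1 p.2) := by
  have hloc : ∀ n : ℕ, ∃ α : E × ℝ → E, (∀ x ∈ Metric.closedBall (0 : E) n, α (x, 0) = x ∧
      ∀ t ∈ Set.Icc (-n : ℝ) n,
        HasDerivWithinAt (fun t => α (x, t)) (X (α (x, t))) (Set.Icc (-n : ℝ) n) t) ∧
      ContinuousOn α (Metric.closedBall (0 : E) n ×ˢ Set.Icc (-n : ℝ) n) := by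
    intro n
    have h0 : (0 : ℝ) ∈ Set.Icc (-n : ℝ) n := by constructor <;> simp
    have hPL : IsPicardLindelof (fun _ => X) (⟨0, h0⟩ : Set.Icc (-n : ℝ) n) 0
        (n + L * n) n L K :=
      IsPicardLindelof.of_time_independent (fun x _ => hL x) hX.lipschitzOnWith (by simp)
    exact hPL.exists_forall_mem_closedBall_eq_hasDerivWithinAt_continuousOn
  choose α hα hαc using hloc
  have hderiv : ∀ (n : ℕ) (x : E) (t : ℝ), ‖x‖ ≤ n → t ∈ Set.Ioo (-n : ℝ) n →
      HasDerivAt (fun t => α n (x, t)) (X (α n (x, t))) t := fun n x t hx ht =>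
    ((hα n x (by simpa using hx)).2 t (Set.Ioo_subset_Icc_self ht)).hasDerivAt
      (Icc_mem_nhds ht.1 ht.2)
  have huniq : ∀ (m n : ℕ) (x : E) (t : ℝ), m ≤ n → ‖x‖ ≤ m →
      t ∈ Set.Ioo (-m : ℝ) m → α m (x, t) = α n (x, t) := by
    intro m n x t hmn hx ht
    have hmn' : (m : ℝ) ≤ n := by exact_mod_cast hmn
    have hm : (0 : ℝ) < m := by have := ht.1.trans ht.2; linarith
    refine ODE_solution_unique_of_mem_Ioo (v := fun _ => X) (s := fun _ => Set.univ) (t₀ := 0)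
      (f := fun t => α m (x, t)) (g := fun t => α n (x, t))
      (fun _ _ => hX.lipschitzOnWith) ⟨by linarith, hm⟩
      (fun t ht => ⟨hderiv m x t hx ht, trivial⟩)
      (fun t ht => ⟨hderiv n x t (hx.trans hmn') ⟨by linarith [ht.1], by linarith [ht.2]⟩, trivial⟩)
      ?_ ht
    rw [(hα m x (by simpa using hx)).1, (hα n x (by simpa using hx.trans hmn')).1]
  set N : ℝ → E → ℕ := fun t x => ⌈|t| + ‖x‖⌉₊ + 1 with hN
  have hNx : ∀ t x, ‖x‖ < N t x := fun t x => by
    have := Nat.le_ceil (|t| + ‖x‖); have := abs_nonneg t; simp only [hN]; push_cast; linarith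
  have hNt : ∀ t x, t ∈ Set.Ioo (-(N t x) : ℝ) (N t x) := fun t x => by
    have := Nat.le_ceil (|t| + ‖x‖); have := norm_nonneg x
    refine abs_lt.1 ?_
    simp only [hN]; push_cast; linarith
  have heq : ∀ (n : ℕ) (t : ℝ) (x : E), ‖x‖ ≤ n → t ∈ Set.Ioo (-n : ℝ) n →
      α (N t x) (x, t) = α n (x, t) := by
    intro n t x hx ht
    rcases le_total n (N t x) with h | h
    · exact (huniq n _ x t h hx ht).symm
    · exact huniq _ n x t h (hNx t x).le (hNt t x)
  refine ⟨fun t x => α (N t x) (x, t), fun x => ?_, fun x t => ?_, ?_⟩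
  · exact (hα _ x (by simpa using (hNx 0 x).le)).1
  · refine (hderiv (N t x) x t (hNx t x).le (hNt t x)).congr_of_eventuallyEq ?_
    filter_upwards [isOpen_Ioo.mem_nhds (hNt t x)] with τ hτ
    exact heq _ _ _ (hNx t x).le hτ
  · rw [continuous_iff_continuousAt]
    rintro ⟨t, x⟩
    set n := N t x with hn
    have hball : ∀ᶠ p : ℝ × E in 𝓝 (t, x), p.1 ∈ Set.Ioo (-n : ℝ) n ∧ ‖p.2‖ < n :=
      (continuous_fst.continuousAt.eventually (isOpen_Ioo.mem_nhds (hNt t x))).and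
        (continuous_snd.norm.continuousAt.eventually_lt continuousAt_const (hNx t x))
    have h1 : ContinuousAt (fun p : ℝ × E => α n (p.2, p.1)) (t, x) := by
      refine ContinuousAt.comp (f := fun p : ℝ × E => (p.2, p.1)) (g := α n) ?_
        (by fun_prop)
      refine (hαc n).continuousAt (prod_mem_nhds ?_ (Icc_mem_nhds (hNt t x).1 (hNt t x).2))
      exact Metric.closedBall_mem_nhds_of_mem (by simpa using hNx t x)
    refine h1.congr ?_
    filter_upwards [hball] with p hp
    exact (heq n _ _ hp.2.le hp.1).symm

/-- Two integral curves of a globally Lipschitz field that agree at time `0` agree forever. -/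
theorem LipschitzWith.integralCurve_unique {E : Type*} [NormedAddCommGroup E] [NormedSpace ℝ E]
    {X : E → E} {K : ℝ≥0} (hX : LipschitzWith K X) {f g : ℝ → E}
    (hf : ∀ t, HasDerivAt f (X (f t)) t) (hg : ∀ t, HasDerivAt g (X (g t)) t)
    (h0 : f 0 = g 0) : f = g :=
  ODE_solution_unique_univ (v := fun _ => X) (s := fun _ => Set.univ)
    (fun _ => hX.lipschitzOnWith) (fun t => ⟨hf t, trivial⟩) (fun t => ⟨hg t, trivial⟩) h0

/-- A Lipschitz and bounded field on the level set `{r = 1}` of a Lipschitz gauge `r` extends to a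
bounded Lipschitz field on the whole space: homogeneously inside `{r ≤ 1}` and radially constant
outside. -/
theorem LipschitzOnWith.lipschitz_radial_extension {E F : Type*} [NormedAddCommGroup E]
    [NormedSpace ℝ E] [NormedAddCommGroup F] [NormedSpace ℝ F] {r : E → ℝ} {C K B : ℝ≥0}
    (hr00 : r 0 = 0) (hr0 : ∀ x, ‖x‖ ≤ r x) (hrC : LipschitzWith C r)
    (hr1 : ∀ x, x ≠ 0 → r ((r x)⁻¹ • x) = 1)
    {X : E → F} (hX : LipschitzOnWith K X {x | r x = 1}) (hB : ∀ x, r x = 1 → ‖X x‖ ≤ B) :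
    LipschitzWith (C * B + K * (1 + C)) (fun x => min (r x) 1 • X ((r x)⁻¹ • x)) := by
  have hpos : ∀ x, x ≠ 0 → 0 < r x := fun x hx => (norm_pos_iff.2 hx).trans_le (hr0 x)
  have hrxy : ∀ x y, |r x - r y| ≤ C * ‖x - y‖ := fun x y => by
    simpa [Real.dist_eq, dist_eq_norm] using hrC.dist_le_mul x y
  have hzero : ∀ x, ‖min (r x) 1 • X ((r x)⁻¹ • x)‖ ≤ C * B * ‖x‖ := by
    intro x
    rcases eq_or_ne x 0 with rfl | hx
    · simp [hr00]
    have h1 : |min (r x) 1| ≤ C * ‖x‖ := by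
      rw [abs_of_nonneg (le_min (hpos x hx).le zero_le_one)]
      have := (le_abs_self _).trans (hrxy x 0)
      rw [hr00, sub_zero, sub_zero] at this
      exact (min_le_left _ _).trans this
    rw [norm_smul, Real.norm_eq_abs]
    calc _ ≤ (C * ‖x‖) * B := by gcongr; exact hB _ (hr1 x hx)
      _ = _ := by ring
  refine LipschitzWith.of_dist_le_mul fun x y => ?_
  rw [dist_eq_norm, dist_eq_norm]
  have hCB : (C * B : ℝ) ≤ C * B + K * (1 + C) := le_add_of_nonneg_right (by positivity)
  push_cast
  rcases eq_or_ne x 0 with rfl | hx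
  · simp only [hr00, zero_smul, min_eq_left zero_le_one, zero_sub, norm_neg]
    exact (hzero y).trans (by gcongr)
  rcases eq_or_ne y 0 with rfl | hy
  · simp only [hr00, zero_smul, min_eq_left zero_le_one, sub_zero]
    exact (hzero x).trans (by gcongr)
  have hx' := hpos x hx
  have hy' := hpos y hy
  have hm : |min (r x) 1 - min (r y) 1| ≤ C * ‖x - y‖ :=
    (abs_min_sub_min_le_max _ _ _ _).trans (max_le (hrxy x y) (by simpa using by positivity))
  have hXX : ‖X ((r x)⁻¹ • x) - X ((r y)⁻¹ • y)‖ ≤ K * ‖(r x)⁻¹ • x - (r y)⁻¹ • y‖ := by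
    simpa [dist_eq_norm] using hX.dist_le_mul _ (hr1 x hx) _ (hr1 y hy)
  have hdiff : r y * ‖(r x)⁻¹ • x - (r y)⁻¹ • y‖ ≤ (1 + C) * ‖x - y‖ := by
    have e : r y * ‖(r x)⁻¹ • x - (r y)⁻¹ • y‖ = ‖(x - y) + ((r y - r x) * (r x)⁻¹) • x‖ := by
      rw [← abs_of_pos hy', ← Real.norm_eq_abs, ← norm_smul, Real.norm_eq_abs, abs_of_pos hy',
        smul_sub, smul_smul, smul_smul, mul_inv_cancel₀ hy'.ne', sub_mul, mul_inv_cancel₀ hx'.ne',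
        sub_smul]
      congr 1
      simp only [one_smul]
      abel
    rw [e]
    refine (norm_add_le _ _).trans ?_
    rw [add_mul, one_mul, norm_smul, norm_mul, norm_inv, mul_assoc, Real.norm_eq_abs,
      Real.norm_eq_abs, abs_of_pos hx']
    have h1 : (r x)⁻¹ * ‖x‖ ≤ 1 := by
      rw [inv_mul_le_iff₀ hx', mul_one]; exact hr0 x
    have h2 : |r y - r x| ≤ C * ‖x - y‖ := by rw [abs_sub_comm]; exact hrxy x y
    have h3 : |r y - r x| * ((r x)⁻¹ * ‖x‖) ≤ C * ‖x - y‖ :=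
      (mul_le_of_le_one_right (abs_nonneg _) h1).trans h2
    linarith
  have e : min (r x) 1 • X ((r x)⁻¹ • x) - min (r y) 1 • X ((r y)⁻¹ • y)
      = (min (r x) 1 - min (r y) 1) • X ((r x)⁻¹ • x)
        + min (r y) 1 • (X ((r x)⁻¹ • x) - X ((r y)⁻¹ • y)) := by
    rw [sub_smul, smul_sub]; abel
  rw [e]
  refine (norm_add_le _ _).trans ?_
  rw [norm_smul, norm_smul, Real.norm_eq_abs, Real.norm_eq_abs,
    abs_of_nonneg (le_min hy'.le zero_le_one)]
  calc _ ≤ (C * ‖x - y‖) * B + r y * (K * ‖(r x)⁻¹ • x - (r y)⁻¹ • y‖) := by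
        gcongr
        · exact hB _ (hr1 x hx)
        · exact min_le_left _ _
    _ = (C * ‖x - y‖) * B + K * (r y * ‖(r x)⁻¹ • x - (r y)⁻¹ • y‖) := by ring
    _ ≤ (C * ‖x - y‖) * B + K * ((1 + C) * ‖x - y‖) := by gcongr
    _ = _ := by ring

namespace Lemniscate

/-! ### Flows on the three-sphere -/

/-- The real inner product of `ℂ²`. -/
def realInner (x y : ℂ × ℂ) : ℝ := inner ℝ x.1 y.1 + inner ℝ x.2 y.2

theorem realInner_self (x : ℂ × ℂ) : realInner x x = ‖x.1‖ ^ 2 + ‖x.2‖ ^ 2 := by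
  simp [realInner]

theorem mem_S3_iff {x : ℂ × ℂ} : x ∈ S3 ↔ realInner x x = 1 := by
  rw [realInner_self]; rfl

theorem realInner_add_right (x y z : ℂ × ℂ) :
    realInner x (y + z) = realInner x y + realInner x z := by
  simp only [realInner, Prod.fst_add, Prod.snd_add, inner_add_right]; ring

theorem realInner_smul_right (c : ℝ) (x y : ℂ × ℂ) :
    realInner x (c • y) = c * realInner x y := by
  simp only [realInner, Prod.smul_fst, Prod.smul_snd, real_inner_smul_right]; ring

theorem realInner_comm (x y : ℂ × ℂ) : realInner x y = realInner y x := by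
  simp only [realInner, real_inner_comm]

theorem realInner_smul_left (c : ℝ) (x y : ℂ × ℂ) :
    realInner (c • x) y = c * realInner x y := by
  rw [realInner_comm, realInner_smul_right, realInner_comm]

theorem realInner_sub_right (x y z : ℂ × ℂ) :
    realInner x (y - z) = realInner x y - realInner x z := by
  simp only [realInner, Prod.fst_sub, Prod.snd_sub, inner_sub_right]; ring

theorem norm_sq_le_realInner_self (x : ℂ × ℂ) : ‖x‖ ^ 2 ≤ realInner x x := by
  rw [realInner_self, Prod.norm_def]
  rcases max_cases ‖x.1‖ ‖x.2‖ with ⟨h, _⟩ | ⟨h, _⟩ <;> rw [h] <;>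
    nlinarith [sq_nonneg ‖x.1‖, sq_nonneg ‖x.2‖]

theorem isCompact_S3 : IsCompact S3 := by
  refine Metric.isCompact_of_isClosed_isBounded
    (isClosed_eq (by fun_prop) continuous_const) ?_
  refine (Metric.isBounded_closedBall (x := (0 : ℂ × ℂ)) (r := 1)).subset fun x hx => ?_
  have h := norm_sq_le_realInner_self x
  rw [mem_S3_iff.1 hx] at h
  rw [mem_closedBall_zero_iff]
  exact (sq_le_one_iff₀ (norm_nonneg _)).1 h

instance : CompactSpace S3 := isCompact_iff_compactSpace.1 isCompact_S3

/-- The Euclidean norm of `ℂ²` (the product norm of Mathlib is the supremum norm). -/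
def euclNorm (x : ℂ × ℂ) : ℝ := √(realInner x x)

theorem euclNorm_eq_norm_toLp (x : ℂ × ℂ) : euclNorm x = ‖WithLp.toLp 2 x‖ := by
  rw [WithLp.prod_norm_eq_of_L2, euclNorm, realInner_self]; rfl

theorem norm_le_euclNorm (x : ℂ × ℂ) : ‖x‖ ≤ euclNorm x :=
  Real.le_sqrt_of_sq_le (norm_sq_le_realInner_self x)

theorem euclNorm_zero : euclNorm 0 = 0 := by simp [euclNorm_eq_norm_toLp]

theorem exists_lipschitzWith_euclNorm : ∃ C : ℝ≥0, LipschitzWith C euclNorm := by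
  have h : euclNorm = (fun y : WithLp 2 (ℂ × ℂ) => ‖y‖) ∘
      (WithLp.prodContinuousLinearEquiv 2 ℝ ℂ ℂ).symm := by
    ext x; exact euclNorm_eq_norm_toLp x
  rw [h]
  exact ⟨_, lipschitzWith_one_norm.comp
    (WithLp.prodContinuousLinearEquiv 2 ℝ ℂ ℂ).symm.lipschitz⟩

theorem euclNorm_eq_one_iff {x : ℂ × ℂ} : euclNorm x = 1 ↔ x ∈ S3 := by
  rw [mem_S3_iff, euclNorm, Real.sqrt_eq_one]

theorem euclNorm_inv_smul {x : ℂ × ℂ} (hx : x ≠ 0) : euclNorm ((euclNorm x)⁻¹ • x) = 1 := by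
  rw [euclNorm_eq_norm_toLp, WithLp.toLp_smul, euclNorm_eq_norm_toLp]
  exact norm_smul_inv_norm (𝕜 := ℝ) (x := WithLp.toLp 2 x) (by simpa using hx)

/-- A Lipschitz vector field on `S³` that is tangent to `S³` has a global flow. -/
theorem exists_flow_S3 {X : ℂ × ℂ → ℂ × ℂ} {K : ℝ≥0} (hX : LipschitzOnWith K X S3)
    (htan : ∀ q ∈ S3, realInner q (X q) = 0) :
    ∃ Φ : ℝ → ℂ × ℂ → ℂ × ℂ, Continuous (fun p : ℝ × ℂ × ℂ => Φ p.1 p.2) ∧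
      (∀ q, Φ 0 q = q) ∧ (∀ q ∈ S3, ∀ t, Φ t q ∈ S3) ∧
      (∀ q ∈ S3, ∀ t, HasDerivAt (fun t => Φ t q) (X (Φ t q)) t) ∧
      (∀ q s t, Φ (s + t) q = Φ s (Φ t q)) ∧
      (∀ q ∈ S3, X q = 0 → ∀ t, Φ t q = q) := by
  obtain ⟨C, hC⟩ := exists_lipschitzWith_euclNorm
  obtain ⟨B, hB⟩ := isCompact_S3.exists_bound_of_continuousOn hX.continuousOn
  have hS : {x | euclNorm x = 1} = S3 := by ext x; exact euclNorm_eq_one_iff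
  have hB' : ∀ x, euclNorm x = 1 → ‖X x‖ ≤ B.toNNReal := fun x hx =>
    (hB x (euclNorm_eq_one_iff.1 hx)).trans (Real.le_coe_toNNReal B)
  have hext := (hS ▸ hX).lipschitz_radial_extension euclNorm_zero norm_le_euclNorm hC
    (fun x hx => euclNorm_inv_smul hx) hB'
  set Y : ℂ × ℂ → ℂ × ℂ := fun x => min (euclNorm x) 1 • X ((euclNorm x)⁻¹ • x) with hY
  have hYX : ∀ q ∈ S3, Y q = X q := fun q hq => by
    simp [hY, euclNorm_eq_one_iff.2 hq]
  have hYb : ∀ x, ‖Y x‖ ≤ B.toNNReal := by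
    intro x
    rcases eq_or_ne x 0 with rfl | hx
    · simp [hY, euclNorm_zero]
    · rw [hY]
      simp only
      rw [norm_smul, Real.norm_eq_abs,
          abs_of_nonneg (le_min ((norm_nonneg x).trans (norm_le_euclNorm x)) zero_le_one)]
      exact (mul_le_of_le_one_left (norm_nonneg _) (min_le_right _ _)).trans
        (hB' _ (euclNorm_inv_smul hx))
  have hYt : ∀ x, realInner x (Y x) = 0 := by
    intro x
    rcases eq_or_ne x 0 with rfl | hx
    · simp [hY, euclNorm_zero, realInner]
    · have h := htan _ (euclNorm_eq_one_iff.1 (euclNorm_inv_smul hx))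
      have hx0 : euclNorm x ≠ 0 := ((norm_pos_iff.2 hx).trans_le (norm_le_euclNorm x)).ne'
      rw [realInner_smul_left, mul_eq_zero] at h
      rw [hY]
      simp only
      rw [realInner_smul_right, h.resolve_left (inv_ne_zero hx0), mul_zero]
  obtain ⟨Φ, h0, hΦ, hc⟩ := hext.exists_continuous_flow hYb
  have hS3 : ∀ q ∈ S3, ∀ t, Φ t q ∈ S3 := by
    intro q hq t
    have hd : ∀ t, HasDerivAt (fun t => realInner (Φ t q) (Φ t q)) 0 t := by
      intro t
      have h := hΦ q t
      have h1 : HasDerivAt (fun t => (Φ t q).1) (Y (Φ t q)).1 t := h.fst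
      have h2 : HasDerivAt (fun t => (Φ t q).2) (Y (Φ t q)).2 t := h.snd
      have h3 := h1.norm_sq.add h2.norm_sq
      rw [← mul_add, show inner ℝ (Φ t q).1 (Y (Φ t q)).1 + inner ℝ (Φ t q).2 (Y (Φ t q)).2 = 0
        from hYt _, mul_zero] at h3
      simpa only [realInner_self] using! h3
    have := is_const_of_deriv_eq_zero (fun t => (hd t).differentiableAt)
      (fun t => (hd t).deriv) t 0
    rw [mem_S3_iff, this, h0]
    exact mem_S3_iff.1 hq
  refine ⟨Φ, hc, h0, hS3, fun q hq t => ?_, fun q s t => ?_, fun q hq hXq t => ?_⟩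
  · rw [← hYX _ (hS3 q hq t)]
    exact hΦ q t
  · have h := hext.integralCurve_unique (f := fun s => Φ (s + t) q) (g := fun s => Φ s (Φ t q))
      (fun s => (hΦ q (s + t)).comp_add_const s t) (fun s => hΦ (Φ t q) s) (by simp [h0])
    exact congrFun h s
  · have h := hext.integralCurve_unique (f := fun s => Φ s q) (g := fun _ => q)
      (fun s => hΦ q s) (fun s => by
        have : Y q = 0 := by rw [hYX q hq, hXq]
        change HasDerivAt _ (Y q) s
        rw [this]; exact hasDerivAt_const s q) (by simp [h0])
    exact congrFun h t

/-! ### Fibrations over the circle from flows -/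

/-- A map to the circle is a locally trivial fibration as soon as some flow covers the rotation of
the circle at unit speed. -/
theorem isLocallyTrivialFibration_of_flow {Z : Type} [TopologicalSpace Z] [Nonempty Z]
    {π : Z → Circle} (hπ : Continuous π) {Ψ : ℝ → Z → Z}
    (hΨ : Continuous (fun p : ℝ × Z => Ψ p.1 p.2)) (h0 : ∀ z, Ψ 0 z = z)
    (hadd : ∀ s t z, Ψ (s + t) z = Ψ s (Ψ t z))
    (hrot : ∀ t z, π (Ψ t z) = Circle.exp t * π z) : IsLocallyTrivialFibration π := by
  have hinv : ∀ t z, Ψ t (Ψ (-t) z) = z := fun t z => by rw [← hadd, add_neg_cancel, h0]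
  have hinv' : ∀ t z, Ψ (-t) (Ψ t z) = z := fun t z => by rw [← hadd, neg_add_cancel, h0]
  refine ⟨{z : Z // π z = 1}, inferInstance, ?_, fun x => ?_⟩
  · obtain ⟨z⟩ := ‹Nonempty Z›
    refine ⟨⟨Ψ (-Complex.arg (π z)) z, ?_⟩⟩
    rw [hrot, Circle.exp_neg, Circle.exp_arg, inv_mul_cancel]
  -- a branch of the angle on the complement of `-x`
  set θ : Circle → ℝ := fun y => Complex.arg ((y * x⁻¹ : Circle) : ℂ) + Complex.arg (x : ℂ) with hθ
  have hexp : ∀ y, Circle.exp (θ y) = y := fun y => by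
    rw [hθ, Circle.exp_add, Circle.exp_arg, Circle.exp_arg, inv_mul_cancel_right]
  set U : Set Circle := {y | ((y * x⁻¹ : Circle) : ℂ) ∈ Complex.slitPlane} with hU
  have hcoe : Continuous fun y : Circle => ((y * x⁻¹ : Circle) : ℂ) :=
    continuous_induced_dom.comp (continuous_id.mul continuous_const)
  have hUo : IsOpen U := Complex.isOpen_slitPlane.preimage hcoe
  have hθc : ContinuousOn θ U := fun y hy =>
    ((((Complex.continuousAt_arg hy).comp (f := fun y : Circle => ((y * x⁻¹ : Circle) : ℂ))
      hcoe.continuousAt)).add continuousAt_const).continuousWithinAt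
  have hfib : ∀ z, π (Ψ (-θ (π z)) z) = 1 := fun z => by
    rw [hrot, Circle.exp_neg, hexp, inv_mul_cancel]
  have hfib' : ∀ (y : Circle) (p : {z : Z // π z = 1}), π (Ψ (θ y) p) = y := fun y p => by
    rw [hrot, hexp, p.2, mul_one]
  refine ⟨
    { toFun := fun z => (π z, ⟨Ψ (-θ (π z)) z, hfib z⟩)
      invFun := fun p => Ψ (θ p.1) p.2
      source := π ⁻¹' U
      target := U ×ˢ Set.univ
      map_source' := fun z hz => ⟨hz, trivial⟩
      map_target' := fun p hp => by
        rw [Set.mem_preimage, hfib']; exact hp.1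
      left_inv' := fun z _ => hinv _ _
      right_inv' := fun p _ => by
        refine Prod.ext (hfib' _ _) (Subtype.ext ?_)
        simp only [hfib']
        exact hinv' _ _
      open_source := hUo.preimage hπ
      open_target := hUo.prod isOpen_univ
      continuousOn_toFun := by
        refine hπ.continuousOn.prodMk (Topology.IsInducing.subtypeVal.continuousOn_iff.2 ?_)
        exact hΨ.comp_continuousOn
          ((hθc.comp hπ.continuousOn fun z hz => hz).neg.prodMk continuousOn_id)
      continuousOn_invFun := by
        refine hΨ.comp_continuousOn (ContinuousOn.prodMk
          (hθc.comp continuousOn_fst fun p hp => hp.1) ?_)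
        exact (continuous_subtype_val.comp continuous_snd).continuousOn
      baseSet := U
      open_baseSet := hUo
      source_eq := rfl
      target_eq := rfl
      proj_toFun := fun _ _ => rfl }, ?_⟩
  change ((x * x⁻¹ : Circle) : ℂ) ∈ Complex.slitPlane
  simp

/-! ### Vector fields that advance the phase -/

/-- If the phase of a nonvanishing curve `c` has constant speed `1`, then it advances by `t` in
time `t`. -/
theorem exp_arg_eq_of_deriv {c c' : ℝ → ℂ} (h0 : ∀ t, c t ≠ 0) (hc : ∀ t, HasDerivAt c (c' t) t)
    (him : ∀ t, (conj (c t) * c' t).im = ‖c t‖ ^ 2) (t : ℝ) :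
    Circle.exp (Complex.arg (c t)) = Circle.exp t * Circle.exp (Complex.arg (c 0)) := by
  -- in the rotating frame the phase `u / ‖u‖` has zero derivative
  set u : ℝ → ℂ := fun t => c t * Complex.exp (-(t * Complex.I)) with hu
  have hnorm : ∀ t : ℝ, ‖Complex.exp (-(t * Complex.I))‖ = 1 := fun t => by
    have := Complex.norm_exp_ofReal_mul_I (-t)
    rwa [Complex.ofReal_neg, neg_mul] at this
  have hun : ∀ t, ‖u t‖ = ‖c t‖ := fun t => by rw [hu]; simp only [norm_mul, hnorm, mul_one]
  have hu0 : ∀ t, ‖u t‖ ≠ 0 := fun t => by rw [hun]; exact norm_ne_zero_iff.2 (h0 t)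
  have hexp : ∀ t : ℝ, HasDerivAt (fun t : ℝ => Complex.exp (-(t * Complex.I)))
      (Complex.exp (-(t * Complex.I)) * (-Complex.I)) t := fun t => by
    have h1 : HasDerivAt (fun t : ℝ => -((t : ℂ) * Complex.I)) (-(1 * Complex.I)) t :=
      ((Complex.ofRealCLM.hasDerivAt (x := t)).mul_const Complex.I).neg
    rw [one_mul] at h1
    exact h1.cexp
  have hud : ∀ t : ℝ, HasDerivAt u ((c' t - Complex.I * c t) * Complex.exp (-(t * Complex.I))) t :=
    fun t => by
      convert! (hc t).mul (hexp t) using 1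
      ring
  have hreal : ∀ t, conj (u t) * ((c' t - Complex.I * c t) * Complex.exp (-(t * Complex.I)))
      = ((inner ℝ (u t) ((c' t - Complex.I * c t) * Complex.exp (-(t * Complex.I))) : ℝ) : ℂ) := by
    intro t
    apply Complex.ext
    · rw [Complex.ofReal_re, Complex.inner, mul_comm]
    · rw [Complex.ofReal_im]
      have e : conj (u t) * ((c' t - Complex.I * c t) * Complex.exp (-(t * Complex.I)))
          = (conj (c t) * c' t - Complex.I * (c t * conj (c t)))
            * (Complex.exp (-(t * Complex.I)) * conj (Complex.exp (-(t * Complex.I)))) := by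
        rw [hu]; simp only [map_mul]; ring
      rw [e, Complex.mul_conj, Complex.mul_conj, Complex.normSq_eq_norm_sq,
        Complex.normSq_eq_norm_sq, hnorm]
      have := him t
      rw [one_pow, Complex.ofReal_one, mul_one, Complex.sub_im, this, Complex.I_mul_im,
        Complex.ofReal_re, sub_self]
  have hN : ∀ t, HasDerivAt (fun t => ‖u t‖)
      (inner ℝ (u t) ((c' t - Complex.I * c t) * Complex.exp (-(t * Complex.I))) / ‖u t‖) t := by
    intro t
    have h := (hud t).norm_sq.sqrt (pow_ne_zero 2 (hu0 t))
    simp only [Real.sqrt_sq (norm_nonneg _)] at h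
    convert! h using 1
    rw [mul_div_mul_left _ _ two_ne_zero]
  have hconst : ∀ t, HasDerivAt (fun t => u t / (‖u t‖ : ℂ)) 0 t := by
    intro t
    have h := (hud t).div ((hN t).ofReal_comp) (by exact_mod_cast hu0 t)
    convert! h using 1
    have h0' : (‖u t‖ : ℂ) ≠ 0 := by exact_mod_cast hu0 t
    symm
    rw [div_eq_zero_iff, sub_eq_zero]
    left
    rw [Complex.ofReal_div, ← hreal t, mul_div_assoc', eq_div_iff h0', mul_assoc, ← sq,
      ← Complex.ofReal_pow, ← Complex.normSq_eq_norm_sq, Complex.normSq_eq_conj_mul_self]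
    ring
  have hfin := is_const_of_deriv_eq_zero (fun t => (hconst t).differentiableAt)
      (fun t => (hconst t).deriv) t 0
  have hcirc : ∀ t, ((Circle.exp (Complex.arg (c t)) : Circle) : ℂ) = c t / ‖c t‖ := fun t => by
    rw [Circle.coe_exp, eq_div_iff (by exact_mod_cast norm_ne_zero_iff.2 (h0 t)), mul_comm,
      Complex.norm_mul_exp_arg_mul_I]
  apply Circle.ext
  rw [Circle.coe_mul, hcirc, hcirc, Circle.coe_exp]
  rw [hun, hun, hu] at hfin
  simp only [Complex.ofReal_zero, zero_mul, neg_zero, Complex.exp_zero, mul_one] at hfin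
  rw [← hfin, mul_div_assoc', mul_left_comm, ← Complex.exp_add, add_neg_cancel, Complex.exp_zero,
    mul_one]

theorem abs_realInner_self_sub_le (x y : ℂ × ℂ) :
    |realInner x x - realInner y y| ≤ 2 * (‖x‖ + ‖y‖) * ‖x - y‖ := by
  have h : ∀ a b : ℂ, |‖a‖ ^ 2 - ‖b‖ ^ 2| ≤ (‖a‖ + ‖b‖) * ‖a - b‖ := fun a b => by
    rw [sq_sub_sq, abs_mul, abs_of_nonneg (by positivity)]
    gcongr
    exact abs_norm_sub_norm_le a b
  rw [realInner_self, realInner_self, add_sub_add_comm]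
  calc _ ≤ (‖x.1‖ + ‖y.1‖) * ‖(x - y).1‖ + (‖x.2‖ + ‖y.2‖) * ‖(x - y).2‖ :=
        (abs_add_le _ _).trans (add_le_add (h _ _) (h _ _))
    _ ≤ (‖x‖ + ‖y‖) * ‖x - y‖ + (‖x‖ + ‖y‖) * ‖x - y‖ := by
        gcongr <;> first | exact norm_fst_le _ | exact norm_snd_le _
    _ = _ := by ring

/-- Scaling the inversion `T / ⟪T, T⟫` of a Lipschitz field `T` by `f²` gives a Lipschitz field, even
across the zeros of `T`, provided that `T` dominates `f`. -/
theorem exists_lipschitzOnWith_sq_div_smul {S : Set (ℂ × ℂ)} {f : ℂ × ℂ → ℝ}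
    {T : ℂ × ℂ → ℂ × ℂ} {K₁ K₂ : ℝ≥0} {c : ℝ} (hc : 0 < c) (hf0 : ∀ q, 0 ≤ f q)
    (hf : LipschitzOnWith K₁ f S) (hT : LipschitzOnWith K₂ T S)
    (hfT : ∀ q ∈ S, c * f q ≤ ‖T q‖) :
    ∃ K, LipschitzOnWith K (fun q => (f q ^ 2 / realInner (T q) (T q)) • T q) S := by
  set Q : ℂ × ℂ → ℝ := fun q => realInner (T q) (T q) with hQ
  have hQT : ∀ q, ‖T q‖ ^ 2 ≤ Q q := fun q => norm_sq_le_realInner_self _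
  have hle : ∀ p ∈ S, ∀ q ∈ S, f p ≤ f q →
      ‖(f p ^ 2 / Q p) • T p - (f q ^ 2 / Q q) • T q‖
        ≤ (5 / c ^ 2 * K₂ + 2 / c * K₁) * ‖p - q‖ := by
    intro p hp q hq hpq
    have hfd : |f p - f q| ≤ K₁ * ‖p - q‖ := by
      simpa [Real.dist_eq, dist_eq_norm] using hf.dist_le_mul p hp q hq
    have hTd : ‖T p - T q‖ ≤ K₂ * ‖p - q‖ := by
      simpa [dist_eq_norm] using hT.dist_le_mul p hp q hq
    have ha : c * f p ≤ ‖T p‖ := hfT p hp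
    have hb : c * f q ≤ ‖T q‖ := hfT q hq
    rcases (norm_nonneg (T q)).eq_or_lt with hb0 | hb0
    · have hq0 : f q = 0 := by nlinarith [hf0 q]
      have hp0 : f p = 0 := le_antisymm (hpq.trans hq0.le) (hf0 p)
      simp only [hq0, hp0, ne_eq, OfNat.ofNat_ne_zero, not_false_eq_true, zero_pow, zero_div,
        zero_smul, sub_self, norm_zero]
      positivity
    have hQq : 0 < Q q := (by positivity : 0 < ‖T q‖ ^ 2).trans_le (hQT q)
    have hbQ : ‖T q‖ / Q q ≤ ‖T q‖⁻¹ := by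
      rw [div_le_iff₀ hQq, inv_mul_eq_div, le_div_iff₀ hb0, ← sq]; exact hQT q
    have hfb : f q * ‖T q‖⁻¹ ≤ 1 / c := by
      rw [← div_eq_mul_inv, div_le_div_iff₀ hb0 hc]; linarith
    have hsecond : ‖((f p ^ 2 - f q ^ 2) / Q q) • T q‖ ≤ 2 / c * K₁ * ‖p - q‖ := by
      rw [norm_smul, Real.norm_eq_abs, abs_div, abs_of_pos hQq, div_mul_eq_mul_div, mul_div_assoc,
        sq_sub_sq, abs_mul, abs_of_nonneg (add_nonneg (hf0 p) (hf0 q))]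
      calc (f p + f q) * |f p - f q| * (‖T q‖ / Q q)
          ≤ (2 * f q) * (K₁ * ‖p - q‖) * ‖T q‖⁻¹ := by
            gcongr
            · exact mul_nonneg (by linarith [hf0 q]) (by positivity)
            · linarith [hf0 q]
            · linarith
        _ = 2 * (f q * ‖T q‖⁻¹) * (K₁ * ‖p - q‖) := by ring
        _ ≤ 2 * (1 / c) * (K₁ * ‖p - q‖) := by gcongr
        _ = _ := by ring
    rcases (hf0 p).eq_or_lt with hp0 | hp0
    · rw [← hp0] at hsecond ⊢
      have e : ((0 : ℝ) ^ 2 / Q p) • T p - (f q ^ 2 / Q q) • T q = ((0 ^ 2 - f q ^ 2) / Q q) • T q := by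
        rw [sub_div, sub_smul]; simp
      rw [e, add_mul]
      exact hsecond.trans (le_add_of_nonneg_left (by positivity))
    have ha0 : 0 < ‖T p‖ := (mul_pos hc hp0).trans_le ha
    have hQp : 0 < Q p := (by positivity : 0 < ‖T p‖ ^ 2).trans_le (hQT p)
    have hfa : f p * ‖T p‖⁻¹ ≤ 1 / c := by
      rw [← div_eq_mul_inv, div_le_div_iff₀ ha0 hc]; linarith
    have hfb' : f p * ‖T q‖⁻¹ ≤ 1 / c := le_trans (by gcongr) hfb
    have hpQ : (Q p)⁻¹ ≤ ‖T p‖⁻¹ ^ 2 := by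
      rw [inv_pow]; exact inv_anti₀ (by positivity) (hQT p)
    have hQd : |Q q - Q p| ≤ 2 * (‖T p‖ + ‖T q‖) * ‖T p - T q‖ := by
      rw [abs_sub_comm]
      exact abs_realInner_self_sub_le _ _
    have hfirst : ‖(f p ^ 2) • ((Q p)⁻¹ • T p - (Q q)⁻¹ • T q)‖ ≤ 5 / c ^ 2 * K₂ * ‖p - q‖ := by
      have e : (Q p)⁻¹ • T p - (Q q)⁻¹ • T q
          = (Q p)⁻¹ • (T p - T q) + ((Q q - Q p) / (Q p * Q q)) • T q := by
        rw [smul_sub, sub_add, ← sub_smul]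
        congr 2
        field_simp
        ring
      rw [e, norm_smul, Real.norm_eq_abs, abs_of_nonneg (sq_nonneg _)]
      have h1 : ‖(Q p)⁻¹ • (T p - T q)‖ ≤ ‖T p‖⁻¹ ^ 2 * (K₂ * ‖p - q‖) := by
        rw [norm_smul, norm_inv, Real.norm_eq_abs, abs_of_pos hQp]
        gcongr
      have h2 : ‖((Q q - Q p) / (Q p * Q q)) • T q‖
          ≤ 2 * (‖T p‖⁻¹ * ‖T q‖⁻¹ + ‖T p‖⁻¹ ^ 2) * (K₂ * ‖p - q‖) := by
        rw [norm_smul, Real.norm_eq_abs, abs_div, abs_of_pos (mul_pos hQp hQq)]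
        calc |Q q - Q p| / (Q p * Q q) * ‖T q‖ = |Q q - Q p| * (Q p)⁻¹ * (‖T q‖ / Q q) := by
              field_simp
          _ ≤ (2 * (‖T p‖ + ‖T q‖) * (K₂ * ‖p - q‖)) * ‖T p‖⁻¹ ^ 2 * ‖T q‖⁻¹ := by
              gcongr
              exact hQd.trans (by gcongr)
          _ = _ := by field_simp
      calc f p ^ 2 * ‖(Q p)⁻¹ • (T p - T q) + ((Q q - Q p) / (Q p * Q q)) • T q‖
          ≤ f p ^ 2 * (‖T p‖⁻¹ ^ 2 * (K₂ * ‖p - q‖)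
            + 2 * (‖T p‖⁻¹ * ‖T q‖⁻¹ + ‖T p‖⁻¹ ^ 2) * (K₂ * ‖p - q‖)) := by
            gcongr
            exact (norm_add_le _ _).trans (add_le_add h1 h2)
        _ = ((f p * ‖T p‖⁻¹) ^ 2 + 2 * ((f p * ‖T p‖⁻¹) * (f p * ‖T q‖⁻¹)
            + (f p * ‖T p‖⁻¹) ^ 2)) * (K₂ * ‖p - q‖) := by ring
        _ ≤ ((1 / c) ^ 2 + 2 * ((1 / c) * (1 / c) + (1 / c) ^ 2)) * (K₂ * ‖p - q‖) := by
            gcongr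
        _ = _ := by ring
    have e : (f p ^ 2 / Q p) • T p - (f q ^ 2 / Q q) • T q
        = (f p ^ 2) • ((Q p)⁻¹ • T p - (Q q)⁻¹ • T q) + ((f p ^ 2 - f q ^ 2) / Q q) • T q := by
      simp only [smul_sub, smul_smul, sub_smul, div_eq_mul_inv, sub_mul]
      abel
    rw [e, add_mul]
    exact (norm_add_le _ _).trans (add_le_add hfirst hsecond)
  refine ⟨(5 / c ^ 2 * K₂ + 2 / c * K₁).toNNReal, LipschitzOnWith.of_dist_le_mul fun p hp q hq => ?_⟩
  rw [Real.coe_toNNReal _ (by positivity)]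
  rcases le_total (f p) (f q) with h | h
  · rw [dist_eq_norm, dist_eq_norm]; exact hle p hp q hq h
  · rw [dist_comm, dist_comm p, dist_eq_norm, dist_eq_norm]; exact hle q hq p hp h

/-! ### Phase-regular maps fibre the complement of their nodal set -/

/-- The gradient at `q` of the real function `Im (ζ̄ F)` on `ℂ²`. For `ζ = F q` this is `|F|²` times
the gradient of `arg F`. -/
def phaseGrad (F : ℂ × ℂ → ℂ) (q : ℂ × ℂ) (ζ : ℂ) : ℂ × ℂ :=
  (((conj ζ * fderiv ℝ F q (1, 0)).im : ℂ) + ((conj ζ * fderiv ℝ F q (Complex.I, 0)).im : ℂ)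
      * Complex.I,
    ((conj ζ * fderiv ℝ F q (0, 1)).im : ℂ) + ((conj ζ * fderiv ℝ F q (0, Complex.I)).im : ℂ)
      * Complex.I)

/-- The part of `phaseGrad` that is tangent to the sphere. -/
def tangentGrad (F : ℂ × ℂ → ℂ) (q : ℂ × ℂ) (ζ : ℂ) : ℂ × ℂ :=
  phaseGrad F q ζ - realInner q (phaseGrad F q ζ) • q

theorem realInner_phaseGrad (F : ℂ × ℂ → ℂ) (q : ℂ × ℂ) (ζ : ℂ) (w : ℂ × ℂ) :
    realInner (phaseGrad F q ζ) w = (conj ζ * fderiv ℝ F q w).im := by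
  have hw : w = w.1.re • ((1, 0) : ℂ × ℂ) + w.1.im • ((Complex.I, 0) : ℂ × ℂ)
      + w.2.re • ((0, 1) : ℂ × ℂ) + w.2.im • ((0, Complex.I) : ℂ × ℂ) := by
    apply Prod.ext <;> apply Complex.ext <;> simp
  conv_rhs => rw [hw]
  simp only [map_add, map_smul, mul_add, Complex.add_im, Complex.real_smul]
  simp [realInner, phaseGrad, Complex.inner, mul_left_comm _ (Complex.ofReal _)]
  ring

theorem realInner_tangentGrad {F : ℂ × ℂ → ℂ} {q : ℂ × ℂ} (hq : q ∈ S3) (ζ : ℂ) :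
    realInner q (tangentGrad F q ζ) = 0 := by
  rw [tangentGrad, realInner_sub_right, realInner_smul_right, mem_S3_iff.1 hq, mul_one, sub_self]

theorem im_fderiv_tangentGrad {F : ℂ × ℂ → ℂ} {q : ℂ × ℂ} (hq : q ∈ S3) (ζ : ℂ) :
    (conj ζ * fderiv ℝ F q (tangentGrad F q ζ)).im
      = realInner (tangentGrad F q ζ) (tangentGrad F q ζ) := by
  have h : phaseGrad F q ζ = tangentGrad F q ζ + realInner q (phaseGrad F q ζ) • q := by
    rw [tangentGrad]; abel
  rw [← realInner_phaseGrad, h, realInner_comm, realInner_add_right, realInner_smul_right,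
    realInner_comm _ q, realInner_tangentGrad hq, mul_zero, add_zero]

/-- `F` is phase-regular on `S³`: its phase has no critical points on `S³` off the nodal set, and at
the points of the nodal set no real linear form `Im (ζ̄ ·)`, `|ζ| = 1`, of the tangential
differential of `F` vanishes, which says that `F` restricted to `S³` is a submersion there. The
condition `|F q| ζ = F q` makes `ζ` the phase of `F q` in the first case and arbitrary in the
second. -/
def IsPhaseRegularOnS3 (F : ℂ × ℂ → ℂ) : Prop :=
  ∀ q ∈ S3, ∀ ζ : ℂ, ‖ζ‖ = 1 → (‖F q‖ : ℂ) * ζ = F q →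
    ∃ w, realInner q w = 0 ∧ (conj ζ * fderiv ℝ F q w).im ≠ 0

theorem dArg_apply {E : Type*} [NormedAddCommGroup E] [NormedSpace ℝ E] {g : E → ℂ} {x : E}
    (hg : DifferentiableAt ℝ g x) (hx : g x ≠ 0) (w : E) :
    dArg g x w = (fderiv ℝ g x w / g x).im := by
  have h1 : HasFDerivAt (fun y => g y / g x) ((g x)⁻¹ • fderiv ℝ g x) x := by
    simpa only [div_eq_mul_inv] using! hg.hasFDerivAt.mul_const (g x)⁻¹
  have h2 : g x / g x = 1 := div_self hx
  have h3 : HasFDerivAt (fun y => Complex.log (g y / g x)) ((g x)⁻¹ • fderiv ℝ g x) x := by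
    have hlog : HasDerivAt Complex.log 1 (g x / g x) := by
      simpa [h2] using Complex.hasDerivAt_log (z := 1) Complex.one_mem_slitPlane
    have := hlog.complexToReal_fderiv.comp x h1
    simpa [Function.comp_def] using! this
  have h4 := (Complex.imCLM.hasFDerivAt (x := Complex.log (g x / g x))).comp x h3
  have h5 : HasFDerivAt (fun y => Complex.arg (g y / g x))
      (Complex.imCLM.comp ((g x)⁻¹ • fderiv ℝ g x)) x := by
    simpa only [Function.comp_def, Complex.imCLM_apply, Complex.log_im] using! h4
  rw [dArg, h5.fderiv]
  simp [div_eq_inv_mul]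

theorem im_div_eq (z w : ℂ) : (w / z).im = (conj z * w).im / ‖z‖ ^ 2 := by
  rw [div_eq_mul_inv, Complex.inv_def, ← mul_assoc, mul_comm w, Complex.normSq_eq_norm_sq,
    Complex.im_mul_ofReal, div_eq_mul_inv]

theorem IsPhaseRegularOnS3.not_isPhaseCriticalOnS3 {F : ℂ × ℂ → ℂ} (hF : Differentiable ℝ F)
    (hreg : IsPhaseRegularOnS3 F) (q : ℂ × ℂ) : ¬ IsPhaseCriticalOnS3 F q := by
  rintro ⟨hq, h0, hcrit⟩
  have hn : (‖F q‖ : ℂ) ≠ 0 := by exact_mod_cast norm_ne_zero_iff.2 h0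
  obtain ⟨w, hw, hne⟩ := hreg q hq (F q / ‖F q‖) (by simp [h0]) (mul_div_cancel₀ _ hn)
  apply hne
  have h := hcrit w hw
  rw [dArg_apply (hF q) h0, im_div_eq, div_eq_zero_iff] at h
  have h' := h.resolve_right (by positivity)
  rw [map_div₀, Complex.conj_ofReal, div_mul_eq_mul_div, Complex.div_ofReal_im, h', zero_div]

theorem tangentGrad_smul (F : ℂ × ℂ → ℂ) (q : ℂ × ℂ) (t : ℝ) (ζ : ℂ) :
    tangentGrad F q (t * ζ) = t • tangentGrad F q ζ := by
  have h : phaseGrad F q (t * ζ) = t • phaseGrad F q ζ := by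
    simp only [phaseGrad, map_mul, Complex.conj_ofReal, mul_assoc, Complex.im_ofReal_mul]
    apply Prod.ext <;> simp <;> ring
  rw [tangentGrad, tangentGrad, h, realInner_smul_right, smul_sub, smul_smul]

theorem contDiff_tangentGrad {F : ℂ × ℂ → ℂ} (hF : ContDiff ℝ 2 F) :
    ContDiff ℝ 1 fun p : (ℂ × ℂ) × ℂ => tangentGrad F p.1 p.2 := by
  have hD : ContDiff ℝ 1 (fderiv ℝ F) := hF.fderiv_right (by norm_num)
  have h : ∀ w : ℂ × ℂ, ContDiff ℝ 1
      fun p : (ℂ × ℂ) × ℂ => (((conj p.2 * fderiv ℝ F p.1 w).im : ℝ) : ℂ) := fun w => by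
    have h1 : ContDiff ℝ 1 fun p : (ℂ × ℂ) × ℂ => fderiv ℝ F p.1 w :=
      (hD.comp contDiff_fst).clm_apply contDiff_const
    have h2 : ContDiff ℝ 1 fun p : (ℂ × ℂ) × ℂ => conj p.2 :=
      Complex.conjCLE.contDiff.comp contDiff_snd
    exact Complex.ofRealCLM.contDiff.comp (Complex.imCLM.contDiff.comp (h2.mul h1))
  have hG : ContDiff ℝ 1 fun p : (ℂ × ℂ) × ℂ => phaseGrad F p.1 p.2 :=
    ((h _).add ((h _).mul contDiff_const)).prodMk ((h _).add ((h _).mul contDiff_const))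
  have hI : ContDiff ℝ 1 fun p : (ℂ × ℂ) × ℂ => realInner p.1 (phaseGrad F p.1 p.2) :=
    ((contDiff_fst.fst).inner ℝ hG.fst).add ((contDiff_fst.snd).inner ℝ hG.snd)
  exact hG.sub (hI.smul contDiff_fst)

/-- The tangential phase gradient dominates `|F|` on all of `S³`, by compactness of the set of pairs
of a point and a phase. -/
theorem IsPhaseRegularOnS3.exists_le_norm_tangentGrad {F : ℂ × ℂ → ℂ} (hF : ContDiff ℝ 2 F)
    (hreg : IsPhaseRegularOnS3 F) :
    ∃ c : ℝ, 0 < c ∧ ∀ q ∈ S3, c * ‖F q‖ ≤ ‖tangentGrad F q (F q)‖ := by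
  set C : Set ((ℂ × ℂ) × ℂ) :=
    (S3 ×ˢ Metric.sphere 0 1) ∩ {p | (‖F p.1‖ : ℂ) * p.2 = F p.1} with hC
  have hFc := hF.continuous
  have hCc : IsCompact C := by
    refine (isCompact_S3.prod (isCompact_sphere _ _)).inter_right (isClosed_eq ?_ ?_) <;> fun_prop
  have hpos : ∀ p ∈ C, 0 < ‖tangentGrad F p.1 p.2‖ := by
    rintro ⟨q, ζ⟩ ⟨⟨hq, hζ⟩, hFζ⟩
    rw [norm_pos_iff]
    intro h0
    obtain ⟨w, hw, hne⟩ := hreg q hq ζ (by simpa using hζ) hFζ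
    apply hne
    have h : phaseGrad F q ζ = tangentGrad F q ζ + realInner q (phaseGrad F q ζ) • q := by
      rw [tangentGrad]; abel
    simp only at h0
    rw [← realInner_phaseGrad, h, h0, zero_add, realInner_smul_left, hw, mul_zero]
  obtain ⟨c, hc, hle⟩ : ∃ c : ℝ, 0 < c ∧ ∀ p ∈ C, c ≤ ‖tangentGrad F p.1 p.2‖ := by
    rcases C.eq_empty_or_nonempty with h | h
    · exact ⟨1, one_pos, by simp [h]⟩
    · obtain ⟨p, hp, hmin⟩ := hCc.exists_isMinOn h
        (contDiff_tangentGrad hF).continuous.norm.continuousOn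
      exact ⟨_, hpos p hp, fun x hx => hmin hx⟩
  refine ⟨c, hc, fun q hq => ?_⟩
  rcases eq_or_ne (F q) 0 with h0 | h0
  · simp [h0]
  have hn : (‖F q‖ : ℂ) ≠ 0 := by exact_mod_cast norm_ne_zero_iff.2 h0
  have h := hle (q, F q / ‖F q‖) ⟨⟨hq, by simp [h0]⟩, mul_div_cancel₀ _ hn⟩
  have e : tangentGrad F q (F q) = ‖F q‖ • tangentGrad F q (F q / ‖F q‖) := by
    rw [← tangentGrad_smul, mul_div_cancel₀ _ hn]
  rw [e, norm_smul, norm_norm, mul_comm]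
  gcongr

theorem _root_.ContDiff.exists_lipschitzOnWith_of_isCompact {E F : Type*} [NormedAddCommGroup E]
    [NormedSpace ℝ E] [NormedAddCommGroup F] [NormedSpace ℝ F] {f : E → F} {S : Set E}
    (hf : ContDiff ℝ 1 f) (hS : IsCompact S) : ∃ K : ℝ≥0, LipschitzOnWith K f S :=
  hf.locallyLipschitz.locallyLipschitzOn.exists_lipschitzOnWith_of_compact hS

/-- The open-book theorem: the phase of a phase-regular map is a locally trivial fibration of the
complement of the nodal set. The field `|F|² T / |T|²`, where `T` is the tangential gradient of the
phase times `|F|²`, advances the phase at unit speed; it is Lipschitz and vanishes on the nodal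
set, so that its flow exists for all times and preserves the complement. -/
theorem IsPhaseRegularOnS3.isLocallyTrivialFibration {F : ℂ × ℂ → ℂ} (hF : ContDiff ℝ 2 F)
    (hreg : IsPhaseRegularOnS3 F) (hne : ∃ q ∈ S3, F q ≠ 0) :
    IsLocallyTrivialFibration (phaseMap F) := by
  have hFc := hF.continuous
  obtain ⟨c, hc, hcF⟩ := hreg.exists_le_norm_tangentGrad hF
  obtain ⟨K₂, hK₂⟩ := ((contDiff_tangentGrad hF).comp
    (contDiff_id.prodMk (hF.of_le one_le_two))).exists_lipschitzOnWith_of_isCompact isCompact_S3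
  obtain ⟨K₁, hK₁⟩ := (hF.of_le one_le_two).exists_lipschitzOnWith_of_isCompact isCompact_S3
  have hK₁' : LipschitzOnWith (1 * K₁) (fun q => ‖F q‖) S3 :=
    lipschitzWith_one_norm.comp_lipschitzOnWith hK₁
  set T : ℂ × ℂ → ℂ × ℂ := fun q => tangentGrad F q (F q) with hT
  obtain ⟨K, hK⟩ := exists_lipschitzOnWith_sq_div_smul (T := T) hc (fun q => norm_nonneg (F q))
    hK₁' hK₂ hcF
  set X : ℂ × ℂ → ℂ × ℂ := fun q => (‖F q‖ ^ 2 / realInner (T q) (T q)) • T q with hX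
  obtain ⟨Φ, hΦc, hΦ0, hΦS, hΦd, hΦadd, hΦfix⟩ := exists_flow_S3 hK fun q hq => by
    rw [realInner_smul_right, realInner_tangentGrad hq, mul_zero]
  have hfix : ∀ q ∈ S3, F q = 0 → ∀ t, Φ t q = q := fun q hq h0 =>
    hΦfix q hq (by
      simp only [hX]; rw [h0, norm_zero, zero_pow two_ne_zero, zero_div, zero_smul])
  have hnz : ∀ q ∈ S3, F q ≠ 0 → ∀ t, F (Φ t q) ≠ 0 := fun q hq h0 t h => by
    have h1 := hfix _ (hΦS q hq t) h (-t)
    rw [← hΦadd, neg_add_cancel, hΦ0] at h1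
    exact h0 (h1 ▸ h)
  have hspeed : ∀ q ∈ S3, F q ≠ 0 → (conj (F q) * fderiv ℝ F q (X q)).im = ‖F q‖ ^ 2 := by
    intro q hq h0
    have hTpos : 0 < ‖T q‖ := lt_of_lt_of_le (by positivity) (hcF q hq)
    have hQ : realInner (T q) (T q) ≠ 0 :=
      ((by positivity : 0 < ‖T q‖ ^ 2).trans_le (norm_sq_le_realInner_self _)).ne'
    simp only [hX]
    rw [map_smul, Complex.real_smul, mul_left_comm, Complex.im_ofReal_mul,
      im_fderiv_tangentGrad hq]
    exact div_mul_cancel₀ _ hQ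
  have hphase : ∀ q ∈ S3, F q ≠ 0 → ∀ t, Circle.exp (Complex.arg (F (Φ t q)))
      = Circle.exp t * Circle.exp (Complex.arg (F q)) := by
    intro q hq h0 t
    have h := exp_arg_eq_of_deriv (c := fun t => F (Φ t q))
      (c' := fun t => fderiv ℝ F (Φ t q) (X (Φ t q))) (hnz q hq h0)
      (fun t => ((hF.differentiable (by norm_num)) _).hasFDerivAt.comp_hasDerivAt t (hΦd q hq t))
      (fun t => hspeed _ (hΦS q hq t) (hnz q hq h0 t)) t
    simpa only [hΦ0] using h
  obtain ⟨q₀, hq₀, hFq₀⟩ := hne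
  have : Nonempty ((nodalSet F)ᶜ : Set S3) := ⟨⟨⟨q₀, hq₀⟩, hFq₀⟩⟩
  refine isLocallyTrivialFibration_of_flow (π := phaseMap F)
    (Ψ := fun t q => ⟨⟨Φ t q.1.1, hΦS _ q.1.2 t⟩, hnz _ q.1.2 q.2 t⟩) ?_ ?_ ?_ ?_ ?_
  · have h : ∀ q : ((nodalSet F)ᶜ : Set S3), ((phaseMap F q : Circle) : ℂ) = F q / ‖F q‖ := by
      intro q
      rw [phaseMap, Circle.coe_exp, eq_div_iff (by exact_mod_cast norm_ne_zero_iff.2 q.2), mul_comm,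
        Complex.norm_mul_exp_arg_mul_I]
    refine continuous_induced_rng.2 ?_
    have h2 : Continuous fun q : ((nodalSet F)ᶜ : Set S3) => F q / (‖F q‖ : ℂ) :=
      Continuous.div (by fun_prop) (by fun_prop)
        fun q => by exact_mod_cast norm_ne_zero_iff.2 q.2
    exact h2.congr fun q => (h q).symm
  · refine Continuous.subtype_mk (Continuous.subtype_mk ?_ _) _
    exact hΦc.comp (by fun_prop : Continuous fun p : ℝ × ((nodalSet F)ᶜ : Set S3) =>
      (p.1, ((p.2 : S3) : ℂ × ℂ)))
  · intro q
    exact Subtype.ext (Subtype.ext (hΦ0 _))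
  · intro s t q
    exact Subtype.ext (Subtype.ext (hΦadd _ _ _))
  · intro t q
    exact hphase _ q.1.2 q.2 t

/-! ### Ambient isotopies of the three-sphere -/

theorem AmbientIsotopic.symm {X : Type*} [TopologicalSpace X] [CompactSpace X] [T2Space X]
    {K L : Set X} (h : AmbientIsotopic K L) : AmbientIsotopic L K := by
  obtain ⟨H, hc, h0, h1⟩ := h
  let e : unitInterval × X ≃ unitInterval × X :=
    { toFun := fun x => (x.1, H x.1 x.2)
      invFun := fun x => (x.1, (H x.1).symm x.2)
      left_inv := fun x => by simp
      right_inv := fun x => by simp }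
  have he : Continuous e := continuous_fst.prodMk hc
  refine ⟨fun t => (H t).symm, ?_, fun x => ?_, ?_⟩
  · exact continuous_snd.comp he.homeoOfEquivCompactToT2.symm.continuous
  · rw [Homeomorph.symm_apply_eq, h0]
  · rw [← h1, ← Set.image_comp]
    simp

/-- A continuous family of bijections of a compact Hausdorff space that starts at the identity is an
ambient isotopy. -/
theorem ambientIsotopic_of_bijective {X : Type*} [TopologicalSpace X] [CompactSpace X] [T2Space X]
    {K L : Set X} (H : unitInterval → X → X)
    (hc : Continuous fun x : unitInterval × X => H x.1 x.2) (hbij : ∀ t, Function.Bijective (H t))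
    (h0 : ∀ x, H 0 x = x) (hKL : ∀ x, x ∈ K ↔ H 1 x ∈ L) : AmbientIsotopic K L := by
  have hct : ∀ t, Continuous (Equiv.ofBijective (H t) (hbij t)) := fun t =>
    hc.comp (Continuous.prodMk_right t)
  refine ⟨fun t => (hct t).homeoOfEquivCompactToT2, hc, h0, ?_⟩
  change H 1 '' K = L
  ext y
  constructor
  · rintro ⟨x, hx, rfl⟩
    exact (hKL x).1 hx
  · intro hy
    obtain ⟨x, rfl⟩ := (hbij 1).2 y
    exact ⟨x, (hKL x).2 hy, rfl⟩

theorem exists_add_eq_of_lipschitzWith {E : Type*} [NormedAddCommGroup E] [CompleteSpace E]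
    {f : E → E} {K : ℝ≥0} (hK : K < 1) (hf : LipschitzWith K f) (y : E) : ∃ x, x + f x = y := by
  have hC : ContractingWith K fun x => y - f x :=
    ⟨hK, LipschitzWith.of_dist_le_mul fun a b => by
      rw [dist_sub_left]; exact hf.dist_le_mul a b⟩
  exact ⟨hC.fixedPoint _, by
    have h := hC.fixedPoint_isFixedPt
    rw [Function.IsFixedPt, sub_eq_iff_eq_add] at h
    exact h.symm⟩

theorem add_injective_of_lipschitzWith {E : Type*} [NormedAddCommGroup E]
    {f : E → E} {K : ℝ≥0} (hK : K < 1) (hf : LipschitzWith K f) :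
    Function.Injective fun x => x + f x := by
  intro a b hab
  have h1 : dist a b ≤ K * dist a b := by
    have h := hf.dist_le_mul b a
    have e : a - b = f b - f a := by
      have hab' : a + f a = b + f b := hab
      rw [sub_eq_sub_iff_add_eq_add, hab', add_comm]
    rwa [dist_comm b a, dist_eq_norm, ← e, ← dist_eq_norm] at h
  have hK' : (K : ℝ) < 1 := hK
  by_contra hne
  have := dist_pos.2 hne
  nlinarith

theorem norm_snd_eq_sqrt {q : ℂ × ℂ} (hq : q ∈ S3) : ‖q.2‖ = √(1 - ‖q.1‖ ^ 2) := by
  have h : ‖q.1‖ ^ 2 + ‖q.2‖ ^ 2 = 1 := hq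
  rw [← h, add_sub_cancel_left, Real.sqrt_sq (norm_nonneg _)]

theorem snd_eq_sqrt_mul {q : ℂ × ℂ} (hq : q ∈ S3) :
    q.2 = (√(1 - ‖q.1‖ ^ 2) : ℂ) * (q.2 / ‖q.2‖) := by
  rw [← norm_snd_eq_sqrt hq]
  rcases eq_or_ne q.2 0 with h | h
  · simp [h]
  · rw [mul_div_cancel₀ _ (by exact_mod_cast norm_ne_zero_iff.2 h)]

theorem norm_fst_lt_one_iff {q : ℂ × ℂ} (hq : q ∈ S3) : ‖q.1‖ < 1 ↔ q.2 ≠ 0 := by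
  have h : ‖q.1‖ ^ 2 + ‖q.2‖ ^ 2 = 1 := hq
  rw [← norm_pos_iff]
  constructor <;> intro h1 <;> nlinarith [norm_nonneg q.1, norm_nonneg q.2]

theorem norm_div_norm_self {v : ℂ} (hv : v ≠ 0) : ‖v / (‖v‖ : ℂ)‖ = 1 := by
  simp [hv]

/-- The move `u ↦ u + B u c` of the disc `{v ∈ ℝ₊ c}`, `|c| = 1`, which is a page of the open book
of `S³` with binding `{v = 0}`. -/
def pageMove (B : ℂ → ℂ → ℂ) (q : ℂ × ℂ) : ℂ × ℂ :=
  (q.1 + B q.1 (q.2 / ‖q.2‖),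
    (√(1 - ‖q.1 + B q.1 (q.2 / ‖q.2‖)‖ ^ 2) : ℂ) * (q.2 / ‖q.2‖))

theorem norm_add_lt_one {B : ℂ → ℂ → ℂ}
    (hlip : ∀ c, ‖c‖ = 1 → LipschitzWith (1 / 2) fun u => B u c)
    (hB0 : ∀ u c, 1 / 2 ≤ ‖u‖ → B u c = 0)
    {u c : ℂ} (hc : ‖c‖ = 1) (hu : ‖u‖ < 1) : ‖u + B u c‖ < 1 := by
  rcases le_or_gt (1 / 2) ‖u‖ with h | h
  · rwa [hB0 u c h, add_zero]
  · have h1 := (hlip c hc).dist_le_mul u (1 / 2)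
    rw [hB0 (1 / 2) c (by norm_num), dist_zero_right] at h1
    have h2 : dist u (1 / 2) ≤ ‖u‖ + 1 / 2 := by
      rw [dist_eq_norm]
      exact (norm_sub_le _ _).trans (by norm_num)
    push_cast at h1
    linarith [norm_add_le u (B u c)]

theorem pageMove_of_half_le {B : ℂ → ℂ → ℂ} (hB0 : ∀ u c, 1 / 2 ≤ ‖u‖ → B u c = 0)
    {q : ℂ × ℂ} (hq : q ∈ S3) (h : 1 / 2 ≤ ‖q.1‖) : pageMove B q = q := by
  rw [pageMove, hB0 _ _ h, add_zero, ← snd_eq_sqrt_mul hq]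

theorem snd_pageMove_div_norm {B : ℂ → ℂ → ℂ}
    (hlip : ∀ c, ‖c‖ = 1 → LipschitzWith (1 / 2) fun u => B u c)
    (hB0 : ∀ u c, 1 / 2 ≤ ‖u‖ → B u c = 0)
    {q : ℂ × ℂ} (hq : q ∈ S3) :
    (pageMove B q).2 / ‖(pageMove B q).2‖ = q.2 / ‖q.2‖ := by
  rcases eq_or_ne q.2 0 with h | h
  · simp [pageMove, h]
  have hc := norm_div_norm_self h
  have h1 := norm_add_lt_one hlip hB0 hc ((norm_fst_lt_one_iff hq).2 h)
  have h2 : 0 < √(1 - ‖q.1 + B q.1 (q.2 / ‖q.2‖)‖ ^ 2) :=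
    Real.sqrt_pos.2 (by nlinarith [norm_nonneg (q.1 + B q.1 (q.2 / ‖q.2‖))])
  have h2' : ((√(1 - ‖q.1 + B q.1 (q.2 / ‖q.2‖)‖ ^ 2) : ℝ) : ℂ) ≠ 0 := by exact_mod_cast h2.ne'
  rw [pageMove]
  simp only
  rw [norm_mul, hc, Complex.norm_real, Real.norm_of_nonneg h2.le, mul_one, mul_div_cancel_left₀ _ h2']

theorem pageMove_mem_S3 {B : ℂ → ℂ → ℂ}
    (hlip : ∀ c, ‖c‖ = 1 → LipschitzWith (1 / 2) fun u => B u c)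
    (hB0 : ∀ u c, 1 / 2 ≤ ‖u‖ → B u c = 0)
    {q : ℂ × ℂ} (hq : q ∈ S3) : pageMove B q ∈ S3 := by
  rcases eq_or_ne q.2 0 with h | h
  · rw [pageMove_of_half_le hB0 hq]
    · exact hq
    · have := mt (norm_fst_lt_one_iff hq).1 (not_not.2 h)
      linarith
  have hc := norm_div_norm_self h
  have h1 := norm_add_lt_one hlip hB0 hc ((norm_fst_lt_one_iff hq).2 h)
  change _ ^ 2 + _ ^ 2 = (1 : ℝ)
  rw [pageMove]
  simp only
  rw [norm_mul, hc, Complex.norm_real, Real.norm_of_nonneg (Real.sqrt_nonneg _), mul_one,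
    Real.sq_sqrt (by nlinarith [norm_nonneg (q.1 + B q.1 (q.2 / ‖q.2‖))])]
  ring

theorem pageMove_injOn {B : ℂ → ℂ → ℂ}
    (hlip : ∀ c, ‖c‖ = 1 → LipschitzWith (1 / 2) fun u => B u c)
    (hB0 : ∀ u c, 1 / 2 ≤ ‖u‖ → B u c = 0) :
    Set.InjOn (pageMove B) S3 := by
  intro p hp q hq hpq
  have hc : p.2 / ‖p.2‖ = q.2 / ‖q.2‖ := by
    rw [← snd_pageMove_div_norm hlip hB0 hp, hpq, snd_pageMove_div_norm hlip hB0 hq]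
  have hfst : p.1 + B p.1 (p.2 / ‖p.2‖) = q.1 + B q.1 (q.2 / ‖q.2‖) := congrArg Prod.fst hpq
  have h1 : p.1 = q.1 := by
    rcases eq_or_ne p.2 0 with h | h
    · have h' : q.2 = 0 := by
        rw [h, zero_div, eq_comm, div_eq_zero_iff] at hc
        simpa using hc
      have hp' := mt (norm_fst_lt_one_iff hp).1 (not_not.2 h)
      have hq' := mt (norm_fst_lt_one_iff hq).1 (not_not.2 h')
      rwa [hB0 _ _ (by linarith), hB0 _ _ (by linarith), add_zero, add_zero] at hfst
    · rw [← hc] at hfst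
      exact add_injective_of_lipschitzWith (by norm_num) (hlip _ (norm_div_norm_self h)) hfst
  refine Prod.ext h1 ?_
  rw [snd_eq_sqrt_mul hp, snd_eq_sqrt_mul hq, h1, hc]

theorem exists_pageMove_eq {B : ℂ → ℂ → ℂ}
    (hlip : ∀ c, ‖c‖ = 1 → LipschitzWith (1 / 2) fun u => B u c)
    (hB0 : ∀ u c, 1 / 2 ≤ ‖u‖ → B u c = 0)
    {p : ℂ × ℂ} (hp : p ∈ S3) : ∃ q ∈ S3, pageMove B q = p := by
  rcases eq_or_ne p.2 0 with h | h
  · refine ⟨p, hp, pageMove_of_half_le hB0 hp ?_⟩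
    have := mt (norm_fst_lt_one_iff hp).1 (not_not.2 h)
    linarith
  have hc := norm_div_norm_self h
  set c := p.2 / (‖p.2‖ : ℂ) with hcdef
  obtain ⟨u, hu⟩ := exists_add_eq_of_lipschitzWith (by norm_num) (hlip c hc) p.1
  have hp1 := (norm_fst_lt_one_iff hp).2 h
  have hu1 : ‖u‖ < 1 := by
    by_contra hge
    rw [hB0 u c (by linarith), add_zero] at hu
    exact hge (hu ▸ hp1)
  have h2 : 0 < √(1 - ‖u‖ ^ 2) := Real.sqrt_pos.2 (by nlinarith [norm_nonneg u])
  have h2' : ((√(1 - ‖u‖ ^ 2) : ℝ) : ℂ) ≠ 0 := by exact_mod_cast h2.ne'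
  have hn : ‖(√(1 - ‖u‖ ^ 2) : ℂ) * c‖ = √(1 - ‖u‖ ^ 2) := by
    rw [norm_mul, hc, Complex.norm_real, Real.norm_of_nonneg h2.le, mul_one]
  refine ⟨(u, (√(1 - ‖u‖ ^ 2) : ℂ) * c), ?_, ?_⟩
  · change _ ^ 2 + _ ^ 2 = (1 : ℝ)
    simp only
    rw [hn, Real.sq_sqrt (by nlinarith [norm_nonneg u])]
    ring
  · rw [pageMove]
    simp only
    rw [hn, mul_div_cancel_left₀ _ h2', hu]
    exact Prod.ext rfl (snd_eq_sqrt_mul hp).symm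

/-- An isotopy of the pages of the open book of `S³` with binding `{v = 0}`. It is enough that the
displacement `B` is a contraction on every page and vanishes near the binding. -/
theorem ambientIsotopic_of_pageMove {B : ℂ → ℂ → ℂ}
    (hBc : ∀ u c, ‖c‖ = 1 → ContinuousWithinAt (fun x : ℂ × ℂ => B x.1 x.2) {x | ‖x.2‖ = 1} (u, c))
    (hlip : ∀ c, ‖c‖ = 1 → LipschitzWith (1 / 2) fun u => B u c)
    (hB0 : ∀ u c, 1 / 2 ≤ ‖u‖ → B u c = 0) {K L : Set S3}
    (hKL : ∀ q : S3, q ∈ K ↔ ∃ p ∈ L, (p : ℂ × ℂ) = pageMove B q) : AmbientIsotopic K L := by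
  have hlipt : ∀ (t : unitInterval) (c : ℂ), ‖c‖ = 1 →
      LipschitzWith (1 / 2) fun u => (t : ℂ) * B u c := by
    intro t c hc
    refine LipschitzWith.of_dist_le_mul fun x y => ?_
    rw [dist_eq_norm, ← mul_sub, norm_mul, Complex.norm_real, Real.norm_of_nonneg t.2.1,
      ← dist_eq_norm]
    exact (mul_le_of_le_one_left dist_nonneg t.2.2).trans ((hlip c hc).dist_le_mul x y)
  have hBt0 : ∀ (t : unitInterval) (u c : ℂ), 1 / 2 ≤ ‖u‖ → (t : ℂ) * B u c = 0 :=
    fun t u c h => by rw [hB0 u c h, mul_zero]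
  refine ambientIsotopic_of_bijective
    (fun t q => ⟨pageMove (fun u c => t * B u c) q, pageMove_mem_S3 (hlipt t) (hBt0 t) q.2⟩)
    ?_ (fun t => ⟨?_, ?_⟩) ?_ ?_
  · refine Continuous.subtype_mk ?_ _
    rw [continuous_iff_continuousAt]
    rintro ⟨t, q⟩
    rcases eq_or_ne q.1.2 0 with h | h
    · have hq1 : 1 / 2 < ‖q.1.1‖ := by
        have := mt (norm_fst_lt_one_iff q.2).1 (not_not.2 h)
        linarith
      have hev : ∀ᶠ x : unitInterval × S3 in 𝓝 (t, q), 1 / 2 < ‖x.2.1.1‖ :=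
        ContinuousAt.eventually_lt continuousAt_const (by fun_prop) hq1
      refine ContinuousAt.congr (f := fun x : unitInterval × S3 => (x.2 : ℂ × ℂ)) (by fun_prop) ?_
      filter_upwards [hev] with x hx
      exact (pageMove_of_half_le (hBt0 x.1) x.2.2 hx.le).symm
    · have hcq : ContinuousAt (fun x : unitInterval × S3 => x.2.1.2 / (‖x.2.1.2‖ : ℂ)) (t, q) :=
        ContinuousAt.div (by fun_prop) (by fun_prop) (by exact_mod_cast norm_ne_zero_iff.2 h)
      have hev : ∀ᶠ x : unitInterval × S3 in 𝓝 (t, q), x.2.1.2 ≠ 0 :=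
        ContinuousAt.eventually_ne (by fun_prop) h
      have hBq : ContinuousAt (fun x : unitInterval × S3 =>
          B x.2.1.1 (x.2.1.2 / (‖x.2.1.2‖ : ℂ))) (t, q) := by
        refine (hBc q.1.1 _ (norm_div_norm_self h)).tendsto.comp
          (f := fun x : unitInterval × S3 => (x.2.1.1, x.2.1.2 / (‖x.2.1.2‖ : ℂ)))
          (tendsto_nhdsWithin_iff.2 ⟨ContinuousAt.prodMk (by fun_prop) hcq, ?_⟩)
        filter_upwards [hev] with x hx
        exact norm_div_norm_self hx
      have hu : ContinuousAt (fun x : unitInterval × S3 =>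
          x.2.1.1 + (x.1 : ℂ) * B x.2.1.1 (x.2.1.2 / (‖x.2.1.2‖ : ℂ))) (t, q) :=
        ContinuousAt.add (by fun_prop) (ContinuousAt.mul (by fun_prop) hBq)
      refine hu.prodMk (ContinuousAt.mul ?_ hcq)
      exact Complex.continuous_ofReal.continuousAt.comp
        (Real.continuous_sqrt.continuousAt.comp (continuousAt_const.sub (hu.norm.pow 2)))
  · intro p q hpq
    exact Subtype.ext (pageMove_injOn (hlipt t) (hBt0 t) p.2 q.2 (congrArg Subtype.val hpq))
  · intro p
    obtain ⟨q, hq, hqp⟩ := exists_pageMove_eq (hlipt t) (hBt0 t) p.2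
    exact ⟨⟨q, hq⟩, Subtype.ext hqp⟩
  · intro q
    refine Subtype.ext ?_
    simp only [pageMove, Set.Icc.coe_zero, Complex.ofReal_zero, zero_mul, add_zero]
    exact Prod.ext rfl (snd_eq_sqrt_mul q.2).symm
  · intro q
    rw [hKL]
    simp only [Set.Icc.coe_one, Complex.ofReal_one, one_mul]
    constructor
    · rintro ⟨p, hp, h⟩
      convert hp
      exact h.symm
    · intro h
      exact ⟨_, h, rfl⟩

/-! ### The map `f` as a polynomial in `u` -/

theorem contDiff_conjPow (n : ℤ) {m : WithTop ℕ∞} : ContDiff ℝ m fun v => conjPow v n := by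
  unfold conjPow
  split_ifs
  · exact contDiff_id.pow _
  · exact Complex.conjCLE.contDiff.pow _

/-- The coefficient of `u ^ k` in `semiholMap`, as a function of `v`. -/
def coeffMap (a b : ℝ) (s r ℓ k : ℕ) (v : ℂ) : ℂ :=
  ((braidLaurent a b s ℓ).coeff k).coeff.sum fun m z => z * conjPow v (r * (m / s))

theorem contDiff_coeffMap (a b : ℝ) (s r ℓ k : ℕ) {m : WithTop ℕ∞} :
    ContDiff ℝ m (coeffMap a b s r ℓ k) :=
  ContDiff.sum fun _ _ => contDiff_const.mul (contDiff_conjPow _)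

theorem monic_braidLaurent (a b : ℝ) (s ℓ : ℕ) : (braidLaurent a b s ℓ).Monic :=
  Polynomial.monic_prod_of_monic _ _ fun _ _ => Polynomial.monic_X_sub_C _

theorem natDegree_braidLaurent (a b : ℝ) (s ℓ : ℕ) : (braidLaurent a b s ℓ).natDegree = s := by
  rw [braidLaurent, Polynomial.natDegree_prod_of_monic _ _ fun _ _ => Polynomial.monic_X_sub_C _]
  simp

theorem coeffMap_self (a b : ℝ) (s r ℓ : ℕ) (v : ℂ) : coeffMap a b s r ℓ s v = 1 := by
  have h : (braidLaurent a b s ℓ).coeff s = LaurentPolynomial.C 1 * LaurentPolynomial.T 0 := by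
    have := (monic_braidLaurent a b s ℓ).coeff_natDegree
    rw [natDegree_braidLaurent] at this
    simp [this]
  rw [coeffMap, h, ← LaurentPolynomial.single_eq_C_mul_T, AddMonoidAlgebra.coeff_single,
    Finsupp.sum_single_index (zero_mul _)]
  simp [conjPow]

theorem semiholMap_eq_sum (a b : ℝ) (s r ℓ : ℕ) (q : ℂ × ℂ) :
    semiholMap a b s r ℓ q = ∑ k ∈ Finset.range (s + 1), coeffMap a b s r ℓ k q.2 * q.1 ^ k := by
  rw [semiholMap, Polynomial.sum_over_range _ (by simp), natDegree_braidLaurent]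
  rfl

/-- The complex derivative of `semiholMap` with respect to `u`. -/
def semiholDeriv (a b : ℝ) (s r ℓ : ℕ) (q : ℂ × ℂ) : ℂ :=
  ∑ k ∈ Finset.range (s + 1), coeffMap a b s r ℓ k q.2 * (k * q.1 ^ (k - 1))

theorem hasDerivAt_semiholMap (a b : ℝ) (s r ℓ : ℕ) (w v : ℂ) :
    HasDerivAt (fun w => semiholMap a b s r ℓ (w, v)) (semiholDeriv a b s r ℓ (w, v)) w := by
  simp only [semiholMap_eq_sum, semiholDeriv]
  exact HasDerivAt.fun_sum fun k _ => (hasDerivAt_pow k w).const_mul _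

theorem contDiff_semiholMap (a b : ℝ) (s r ℓ : ℕ) {m : WithTop ℕ∞} :
    ContDiff ℝ m (semiholMap a b s r ℓ) := by
  rw [show semiholMap a b s r ℓ = fun q => _ from funext (semiholMap_eq_sum a b s r ℓ)]
  exact ContDiff.sum fun k _ =>
    ((contDiff_coeffMap a b s r ℓ k).comp contDiff_snd).mul (contDiff_fst.pow k)

theorem contDiff_semiholDeriv (a b : ℝ) (s r ℓ : ℕ) {m : WithTop ℕ∞} :
    ContDiff ℝ m (semiholDeriv a b s r ℓ) :=
  ContDiff.sum fun k _ => ((contDiff_coeffMap a b s r ℓ k).comp contDiff_snd).mul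
    (contDiff_const.mul (contDiff_fst.pow (k - 1)))

/-- For large `|w|` the map `f` is dominated by its leading term `w ^ s`, uniformly in the disc
`|v| ≤ 1`, so that its phase increases along the circles around `0`. -/
theorem exists_re_mul_semiholDeriv_pos (a b : ℝ) {s : ℕ} (r ℓ : ℕ) (hs : 0 < s) :
    ∃ M : ℝ, 1 ≤ M ∧ ∀ w v : ℂ, ‖v‖ ≤ 1 → M ≤ ‖w‖ →
      0 < (w * semiholDeriv a b s r ℓ (w, v) * conj (semiholMap a b s r ℓ (w, v))).re := by
  set A := coeffMap a b s r ℓ with hA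
  have hbound : ∀ k, ∃ C : ℝ, ∀ v ∈ Metric.closedBall (0 : ℂ) 1, ‖A k v‖ ≤ C := fun k =>
    (isCompact_closedBall _ _).exists_bound_of_continuousOn
      (contDiff_coeffMap a b s r ℓ k (m := 0)).continuous.continuousOn
  choose C hC using hbound
  set D : ℝ := ∑ k ∈ Finset.range s, s * |C k| with hD
  have hD0 : 0 ≤ D := Finset.sum_nonneg fun k _ => by positivity
  have hs1 : (1 : ℝ) ≤ s := by exact_mod_cast hs
  have hs0 : (0 : ℝ) < s := by exact_mod_cast hs
  refine ⟨3 * D + 1, by linarith, fun w v hv hw => ?_⟩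
  have hw1 : 1 ≤ ‖w‖ := by linarith
  obtain ⟨n, rfl⟩ := Nat.exists_eq_succ_of_ne_zero hs.ne'
  set W := ‖w‖ ^ n with hW
  have hW0 : 0 < W := by positivity
  have hlow : ∀ c : ℕ → ℂ, (∀ k ∈ Finset.range (n + 1), ‖c k‖ ≤ ((n + 1 : ℕ) : ℝ)) →
      ‖∑ k ∈ Finset.range (n + 1), c k * (A k v * w ^ k)‖ ≤ D * W := by
    intro c hc
    rw [hD, Finset.sum_mul]
    refine norm_sum_le_of_le _ fun k hk => ?_
    rw [norm_mul, norm_mul, norm_pow, mul_assoc]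
    have h1 : ‖A k v‖ ≤ |C k| := (hC k v (by simpa using hv)).trans (le_abs_self _)
    have h2 : ‖w‖ ^ k ≤ W := pow_le_pow_right₀ hw1 (by simpa [Nat.lt_succ_iff] using hk)
    have h3 := hc k hk
    gcongr
  set g := semiholMap a b (n + 1) r ℓ (w, v) with hg
  have hg1 : g = ∑ k ∈ Finset.range (n + 1), 1 * (A k v * w ^ k) + w ^ (n + 1) := by
    rw [hg, semiholMap_eq_sum, Finset.sum_range_succ]
    simp only [coeffMap_self, one_mul, hA]
  have hg2 : w * semiholDeriv a b (n + 1) r ℓ (w, v)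
      = ((n + 1 : ℕ) : ℂ) * g
        + ∑ k ∈ Finset.range (n + 1), ((k : ℂ) - ((n + 1 : ℕ) : ℂ)) * (A k v * w ^ k) := by
    rw [hg1, semiholDeriv, Finset.mul_sum, Finset.sum_range_succ, mul_add, Finset.mul_sum,
      add_right_comm, ← Finset.sum_add_distrib]
    congr 1
    · refine Finset.sum_congr rfl fun k _ => ?_
      rcases k with _ | k
      · simp only [pow_zero]; push_cast; ring
      · simp only [Nat.add_sub_cancel, pow_succ]; ring
    · simp only [coeffMap_self, Nat.add_sub_cancel, pow_succ]; ring
  have he1 := hlow (fun _ => 1) (fun k _ => by simp)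
  have he2 := hlow (fun k => (k : ℂ) - ((n + 1 : ℕ) : ℂ)) (fun k hk => by
    have hk' : k ≤ n + 1 := (Finset.mem_range.1 hk).le
    have e : (k : ℂ) - ((n + 1 : ℕ) : ℂ) = -(((n + 1 - k : ℕ) : ℝ) : ℂ) := by
      rw [Nat.cast_sub hk']; push_cast; ring
    rw [e, norm_neg, Complex.norm_real, Real.norm_of_nonneg (by positivity)]
    exact_mod_cast Nat.sub_le _ _)
  set R := ∑ k ∈ Finset.range (n + 1), ((k : ℂ) - ((n + 1 : ℕ) : ℂ)) * (A k v * w ^ k) with hR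
  have hglow : 2 * D * W < ‖g‖ := by
    have h1 : ‖w ^ (n + 1)‖ ≤ ‖g‖ + D * W := by
      have : w ^ (n + 1) = g - ∑ k ∈ Finset.range (n + 1), 1 * (A k v * w ^ k) := by
        rw [hg1]; ring
      rw [this]
      exact (norm_sub_le _ _).trans (by gcongr)
    rw [norm_pow, pow_succ, ← hW] at h1
    nlinarith
  have hg0 : 0 < ‖g‖ := lt_of_le_of_lt (by positivity) hglow
  have hre : (w * semiholDeriv a b (n + 1) r ℓ (w, v) * conj g).re
      = ((n + 1 : ℕ) : ℝ) * ‖g‖ ^ 2 + (R * conj g).re := by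
    rw [hg2, add_mul, Complex.add_re, mul_assoc, Complex.mul_conj, Complex.normSq_eq_norm_sq]
    congr 1
    rw [← Complex.ofReal_natCast, ← Complex.ofReal_mul, Complex.ofReal_re]
  have hRg : -(R * conj g).re ≤ D * W * ‖g‖ := by
    refine (neg_le_abs _).trans ((Complex.abs_re_le_norm _).trans ?_)
    rw [norm_mul, Complex.norm_conj]
    gcongr
  have h2 : D * W * ‖g‖ ≤ ‖g‖ * ‖g‖ := by
    gcongr
    have : 0 ≤ D * W := by positivity
    linarith
  rw [hre]
  have h3 : D * W * ‖g‖ < ‖g‖ ^ 2 := by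
    rw [sq]
    refine mul_lt_mul_of_pos_right ?_ hg0
    have : 0 ≤ D * W := by positivity
    linarith
  nlinarith [sq_nonneg ‖g‖]

/-! ### Rescaling the stretching factors -/

theorem strand_smul (c a b : ℝ) (s r ℓ j : ℕ) (h : ℝ) :
    strand (c * a) (c * b) s r ℓ j h = c * strand a b s r ℓ j h := by
  simp only [strand]; push_cast; ring

theorem braidPoly_smul (c a b : ℝ) (s r ℓ : ℕ) (u : ℂ) (h : ℝ) :
    braidPoly (c * a) (c * b) s r ℓ (c * u, h) = c ^ s * braidPoly a b s r ℓ (u, h) := by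
  simp only [braidPoly, strand_smul, ← mul_sub, Finset.prod_mul_distrib, Finset.prod_const,
    Finset.card_range]

theorem strandLaurent_smul (c a b : ℝ) (s ℓ j : ℕ) :
    strandLaurent (c * a) (c * b) s ℓ j = LaurentPolynomial.C (c : ℂ) * strandLaurent a b s ℓ j := by
  simp only [strandLaurent, mul_add, mul_sub, ← mul_assoc, ← map_mul]
  push_cast
  ring_nf

theorem coeff_braidLaurent_smul (c a b : ℝ) (s ℓ k : ℕ) :
    (braidLaurent (c * a) (c * b) s ℓ).coeff k * LaurentPolynomial.C (c : ℂ) ^ k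
      = LaurentPolynomial.C (c : ℂ) ^ s * (braidLaurent a b s ℓ).coeff k := by
  have h : (braidLaurent (c * a) (c * b) s ℓ).comp
      (Polynomial.C (LaurentPolynomial.C (c : ℂ)) * Polynomial.X)
      = Polynomial.C (LaurentPolynomial.C (c : ℂ) ^ s) * braidLaurent a b s ℓ := by
    simp only [braidLaurent, Polynomial.prod_comp, Polynomial.sub_comp, Polynomial.X_comp,
      Polynomial.C_comp, strandLaurent_smul]
    simp only [map_mul, ← mul_sub, Finset.prod_mul_distrib, Finset.prod_const, Finset.card_range,
      map_pow]
  have := congrArg (fun P => P.coeff k) h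
  simpa only [Polynomial.comp_C_mul_X_coeff, Polynomial.coeff_C_mul] using this

theorem coeffMap_smul (c a b : ℝ) (s r ℓ k : ℕ) (v : ℂ) :
    coeffMap (c * a) (c * b) s r ℓ k v * c ^ k = c ^ s * coeffMap a b s r ℓ k v := by
  have hsum : ∀ (z : ℂ) (p : ℂ[T;T⁻¹]),
      ((LaurentPolynomial.C z * p).coeff.sum fun m z => z * conjPow v (r * (m / s)))
        = z * p.coeff.sum fun m z => z * conjPow v (r * (m / s)) := by
    intro z p
    induction p using LaurentPolynomial.induction_on' with
    | add p q hp hq =>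
      rw [mul_add, AddMonoidAlgebra.coeff_add, AddMonoidAlgebra.coeff_add,
        Finsupp.sum_add_index', Finsupp.sum_add_index', hp, hq, mul_add] <;> intros <;> ring
    | C_mul_T n y =>
      rw [← mul_assoc, ← map_mul, ← LaurentPolynomial.single_eq_C_mul_T,
        ← LaurentPolynomial.single_eq_C_mul_T, AddMonoidAlgebra.coeff_single,
        AddMonoidAlgebra.coeff_single, Finsupp.sum_single_index (zero_mul _),
        Finsupp.sum_single_index (zero_mul _), mul_assoc]
  have h := congrArg (fun p : ℂ[T;T⁻¹] => p.coeff.sum fun m z => z * conjPow v (r * (m / s)))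
    (coeff_braidLaurent_smul c a b s ℓ k)
  simp only [← map_pow] at h
  rw [hsum, mul_comm, hsum] at h
  rw [mul_comm]
  exact h

theorem semiholMap_smul (c a b : ℝ) (s r ℓ : ℕ) (u v : ℂ) :
    semiholMap (c * a) (c * b) s r ℓ (c * u, v) = c ^ s * semiholMap a b s r ℓ (u, v) := by
  simp only [semiholMap_eq_sum, Finset.mul_sum]
  refine Finset.sum_congr rfl fun k _ => ?_
  rw [mul_pow, ← mul_assoc, coeffMap_smul, mul_assoc]

/-! ### The strands -/

theorem continuous_strand (a b : ℝ) (s r ℓ j : ℕ) : Continuous (strand a b s r ℓ j) := by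
  unfold strand
  fun_prop

theorem strand_re (a b : ℝ) (s r ℓ j : ℕ) (h : ℝ) :
    (strand a b s r ℓ j h).re = a * Real.cos ((r * h + 2 * Real.pi * j) / s) := by
  rw [strand, Complex.add_re, Complex.ofReal_re, Complex.re_ofReal_mul, Complex.I_re, mul_zero,
    add_zero]

theorem strand_im (a b : ℝ) (s r ℓ j : ℕ) (h : ℝ) :
    (strand a b s r ℓ j h).im = b / ℓ * Real.sin (ℓ * ((r * h + 2 * Real.pi * j) / s)) := by
  rw [strand, Complex.add_im, Complex.ofReal_im, Complex.im_ofReal_mul, Complex.I_im, mul_one,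
    zero_add]

/-- Since `s` and `ℓ` are coprime, the strands do not meet. -/
theorem strand_ne {a b : ℝ} (ha : 0 < a) (hb : 0 < b) {s ℓ : ℕ} (r : ℕ) (hs : 0 < s) (hℓ : 0 < ℓ)
    (hsℓ : Nat.Coprime s ℓ) {j k : ℕ} (hj : j < s) (hk : k < s) (hjk : j ≠ k) (h : ℝ) :
    strand a b s r ℓ j h ≠ strand a b s r ℓ k h := by
  intro heq
  have hs0 : (s : ℝ) ≠ 0 := by exact_mod_cast hs.ne'
  have hℓ0 : (ℓ : ℝ) ≠ 0 := by exact_mod_cast hℓ.ne'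
  set A : ℝ := (r * h + 2 * Real.pi * j) / s with hA
  set B : ℝ := (r * h + 2 * Real.pi * k) / s with hB
  have hBA : s * (B - A) = 2 * Real.pi * (k - j) := by
    rw [hA, hB]; field_simp; ring
  have hcos : Real.cos A = Real.cos B := by
    have := congrArg Complex.re heq
    rw [strand_re, strand_re] at this
    exact mul_left_cancel₀ ha.ne' this
  have hsin : Real.sin (ℓ * A) = Real.sin (ℓ * B) := by
    have := congrArg Complex.im heq
    rw [strand_im, strand_im] at this
    exact mul_left_cancel₀ (div_pos hb (by positivity)).ne' this
  have hdvd : ((s : ℤ) ∣ (ℓ : ℤ) * ((k : ℤ) - j)) := by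
    obtain ⟨m, hm | hm⟩ := Real.cos_eq_cos_iff.1 hcos
    · refine ⟨ℓ * m, ?_⟩
      have : ((k : ℝ) - j) = s * m := by
        have hpi := Real.pi_pos.ne'
        rw [hm] at hBA
        apply mul_left_cancel₀ (mul_ne_zero two_ne_zero hpi)
        linear_combination -hBA
      have : ((k : ℤ) - j) = s * m := by exact_mod_cast this
      rw [this]; ring
    · have hz : Real.sin (ℓ * A) = 0 := by
        have e : ℓ * B = ((ℓ * m : ℤ) : ℝ) * (2 * Real.pi) - ℓ * A := by rw [hm]; push_cast; ring
        rw [e, Real.sin_int_mul_two_pi_sub] at hsin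
        linarith
      obtain ⟨n, hn⟩ := Real.sin_eq_zero_iff.1 hz
      refine ⟨m * ℓ - n, ?_⟩
      have : (ℓ : ℝ) * ((k : ℝ) - j) = s * (m * ℓ - n) := by
        have hpi := Real.pi_pos.ne'
        rw [hm] at hBA
        apply mul_left_cancel₀ (mul_ne_zero two_ne_zero hpi)
        linear_combination -(ℓ : ℝ) * hBA + 2 * s * hn
      exact_mod_cast this
  have hdvd' : (s : ℤ) ∣ (k : ℤ) - j :=
    (Nat.isCoprime_iff_coprime.2 hsℓ).dvd_of_dvd_mul_left hdvd
  have := Int.eq_zero_of_abs_lt_dvd hdvd' (by rw [abs_lt]; omega)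
  omega

theorem exp_arg_eq_self {v : ℂ} (hv : ‖v‖ = 1) : Complex.exp (Complex.arg v * Complex.I) = v := by
  have := Complex.norm_mul_exp_arg_mul_I v
  rwa [hv, Complex.ofReal_one, one_mul] at this

theorem exists_exp_eq {c : ℂ} (hc : ‖c‖ = 1) :
    ∃ h ∈ Set.Icc 0 (2 * Real.pi), Complex.exp ((h : ℝ) * Complex.I) = c := by
  rcases le_or_gt 0 (Complex.arg c) with h1 | h1
  · exact ⟨Complex.arg c, ⟨h1, by linarith [Complex.arg_le_pi c, Real.pi_pos]⟩, exp_arg_eq_self hc⟩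
  · refine ⟨Complex.arg c + 2 * Real.pi, ⟨by linarith [Complex.neg_pi_lt_arg c], by linarith⟩, ?_⟩
    push_cast
    rw [add_mul, Complex.exp_add, Complex.exp_two_pi_mul_I, mul_one, exp_arg_eq_self hc]

theorem semiholMap_eq_prod (a b : ℝ) {s : ℕ} (r ℓ : ℕ) (hs : 0 < s) (w : ℂ) {v : ℂ} (hv : ‖v‖ = 1) :
    semiholMap a b s r ℓ (w, v)
      = ∏ j ∈ Finset.range s, (w - strand a b s r ℓ j (Complex.arg v)) := by
  conv_lhs => rw [← exp_arg_eq_self hv]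
  exact semiholMap_exp a b s r ℓ hs w _

theorem semiholDeriv_ne_zero {a b : ℝ} (ha : 0 < a) (hb : 0 < b) {s ℓ : ℕ} (r : ℕ) (hs : 0 < s)
    (hℓ : 0 < ℓ) (hsℓ : Nat.Coprime s ℓ) {w v : ℂ} (hv : ‖v‖ = 1)
    (h0 : semiholMap a b s r ℓ (w, v) = 0) : semiholDeriv a b s r ℓ (w, v) ≠ 0 := by
  rw [semiholMap_eq_prod a b r ℓ hs w hv, Finset.prod_eq_zero_iff] at h0
  obtain ⟨j, hj, hwj⟩ := h0
  have h1 := hasDerivAt_semiholMap a b s r ℓ w v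
  simp only [semiholMap_eq_prod a b r ℓ hs _ hv] at h1
  have h2 := HasDerivAt.fun_finsetProd (u := Finset.range s)
    (f := fun j x => x - strand a b s r ℓ j (Complex.arg v)) (f' := fun _ => 1) (x := w)
    (fun j _ => (hasDerivAt_id w).sub_const _)
  rw [h1.unique h2, Finset.sum_eq_single_of_mem j hj]
  · rw [smul_eq_mul, mul_one, Finset.prod_ne_zero_iff]
    intro k hk
    rw [Finset.mem_erase, Finset.mem_range] at hk
    rw [sub_eq_zero.1 hwj, sub_ne_zero]
    exact strand_ne ha hb r hs hℓ hsℓ (Finset.mem_range.1 hj) hk.2 hk.1.symm _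
  · intro k hk hkj
    rw [smul_eq_mul, mul_one]
    exact Finset.prod_eq_zero (Finset.mem_erase.2 ⟨hkj.symm, hj⟩) hwj

theorem sum_strand_add_two_pi (a b : ℝ) {s : ℕ} (r ℓ : ℕ) (hs : 0 < s) {E : Type*}
    [AddCommMonoid E] (τ : ℂ → E) (h : ℝ) :
    ∑ j ∈ Finset.range s, τ (strand a b s r ℓ j (h + 2 * Real.pi))
      = ∑ j ∈ Finset.range s, τ (strand a b s r ℓ j h) := by
  have hs0 : (s : ℝ) ≠ 0 := by exact_mod_cast hs.ne'
  have hshift : ∀ j, strand a b s r ℓ j (h + 2 * Real.pi) = strand a b s r ℓ (j + r) h := by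
    intro j
    simp only [strand]
    have e : (r * (h + 2 * Real.pi) + 2 * Real.pi * j) / s
      = (r * h + 2 * Real.pi * ((j + r : ℕ) : ℝ)) / s := by push_cast; ring
    rw [e]
  have hper : ∀ j, strand a b s r ℓ (j + s) h = strand a b s r ℓ j h := by
    intro j
    simp only [strand]
    have e : (r * h + 2 * Real.pi * ((j + s : ℕ) : ℝ)) / s
      = (r * h + 2 * Real.pi * j) / s + 2 * Real.pi := by push_cast; field_simp; ring
    rw [e, Real.cos_add_two_pi, mul_add, Real.sin_add_nat_mul_two_pi]
  have hsum : ∀ n, ∑ j ∈ Finset.range s, τ (strand a b s r ℓ (j + n) h)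
      = ∑ j ∈ Finset.range s, τ (strand a b s r ℓ j h) := by
    intro n
    induction n with
    | zero => simp
    | succ n ih =>
      rw [← ih]
      obtain ⟨m, rfl⟩ := Nat.exists_eq_succ_of_ne_zero hs.ne'
      rw [Nat.succ_eq_add_one, Finset.sum_range_succ,
        Finset.sum_range_succ' (fun j => τ (strand a b (m + 1) r ℓ (j + n) h))]
      have h1 : ∀ j, j + (n + 1) = j + 1 + n := fun j => by ring
      have h2 : m + (n + 1) = 0 + n + (m + 1) := by ring
      congr 1
      · exact Finset.sum_congr rfl fun j _ => by rw [h1]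
      · rw [h2, hper]
  simp only [hshift, hsum]

/-! ### Phase-critical points under rescaling -/

theorem isPhaseCritical_iff {E : Type*} [NormedAddCommGroup E] [NormedSpace ℝ E] {g : E → ℂ} {x : E}
    (hg : DifferentiableAt ℝ g x) :
    IsPhaseCritical g x ↔ g x ≠ 0 ∧ ∀ w, (conj (g x) * fderiv ℝ g x w).im = 0 := by
  refine and_congr_right fun h0 => ?_
  rw [ContinuousLinearMap.ext_iff]
  refine forall_congr' fun w => ?_
  rw [dArg_apply hg h0, im_div_eq, _root_.zero_apply, div_eq_zero_iff]
  simp [h0]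

theorem differentiable_braidPoly (a b : ℝ) (s r ℓ : ℕ) :
    Differentiable ℝ (braidPoly a b s r ℓ) := by
  have h : ∀ j, ContDiff ℝ 1 (strand a b s r ℓ j) := fun j => by
    have h1 : ContDiff ℝ 1 fun h : ℝ => a * Real.cos ((r * h + 2 * Real.pi * j) / s) := by
      fun_prop
    have h2 : ContDiff ℝ 1 fun h : ℝ => b / ℓ * Real.sin (ℓ * ((r * h + 2 * Real.pi * j) / s)) := by
      fun_prop
    exact (Complex.ofRealCLM.contDiff.comp h1).add
      ((Complex.ofRealCLM.contDiff.comp h2).mul contDiff_const)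
  exact (contDiff_prod fun j _ => contDiff_fst.sub ((h j).comp contDiff_snd)).differentiable
    one_ne_zero

theorem NoPhaseCritical.smul {a b c : ℝ} (hc : 0 < c) {s r ℓ : ℕ} (h : NoPhaseCritical a b s r ℓ) :
    NoPhaseCritical (c * a) (c * b) s r ℓ := by
  have hc0 : (c : ℂ) ≠ 0 := by exact_mod_cast hc.ne'
  intro u t ht hcrit
  obtain ⟨v, rfl⟩ : ∃ v, u = c * v := ⟨u / c, (mul_div_cancel₀ _ hc0).symm⟩
  rw [isPhaseCritical_iff (differentiable_braidPoly _ _ _ _ _ _)] at hcrit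
  refine h v t ht ((isPhaseCritical_iff (differentiable_braidPoly _ _ _ _ _ _)).2 ?_)
  obtain ⟨h0, h1⟩ := hcrit
  rw [braidPoly_smul] at h0 h1
  refine ⟨right_ne_zero_of_mul h0, fun w => ?_⟩
  have hd : HasFDerivAt (fun x : ℂ × ℝ => ((c : ℂ) * x.1, x.2))
      (((c : ℂ) • ContinuousLinearMap.fst ℝ ℂ ℝ).prod (ContinuousLinearMap.snd ℝ ℂ ℝ)) (v, t) :=
    (hasFDerivAt_fst.const_mul (c : ℂ)).prodMk hasFDerivAt_snd
  have h2 := (differentiable_braidPoly (c * a) (c * b) s r ℓ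
    ((c : ℂ) * v, t)).hasFDerivAt.comp (v, t) hd
  have h3 : HasFDerivAt (fun x : ℂ × ℝ => (c : ℂ) ^ s * braidPoly a b s r ℓ x)
      ((c : ℂ) ^ s • fderiv ℝ (braidPoly a b s r ℓ) (v, t)) (v, t) :=
    (differentiable_braidPoly a b s r ℓ (v, t)).hasFDerivAt.const_mul _
  have h4 : (braidPoly (c * a) (c * b) s r ℓ ∘ fun x : ℂ × ℝ => ((c : ℂ) * x.1, x.2))
      = fun x : ℂ × ℝ => (c : ℂ) ^ s * braidPoly a b s r ℓ x := by
    ext ⟨x, y⟩; exact braidPoly_smul c a b s r ℓ x y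
  rw [h4] at h2
  have h5 := h1 ((c : ℂ) * w.1, w.2)
  have h6 := DFunLike.congr_fun (h2.unique h3) w
  simp only [ContinuousLinearMap.comp_apply, ContinuousLinearMap.prod_apply,
    _root_.smul_apply, ContinuousLinearMap.coe_fst', ContinuousLinearMap.coe_snd',
    smul_eq_mul] at h6
  rw [h6, map_mul, map_pow, Complex.conj_ofReal, mul_mul_mul_comm, ← pow_add,
    ← Complex.ofReal_pow, Complex.im_ofReal_mul, mul_eq_zero] at h5
  exact h5.resolve_left (pow_ne_zero _ hc.ne')

theorem noPhaseCritical_smul_iff {a b c d : ℝ} (hc : 0 < c) (hd : 0 < d) {s r ℓ : ℕ} :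
    NoPhaseCritical (c * a) (c * b) s r ℓ ↔ NoPhaseCritical (d * a) (d * b) s r ℓ := by
  have key : ∀ c d : ℝ, 0 < c → 0 < d → NoPhaseCritical (c * a) (c * b) s r ℓ →
      NoPhaseCritical (d * a) (d * b) s r ℓ := fun c d hc hd h => by
    have := h.smul (div_pos hd hc)
    rwa [← mul_assoc, ← mul_assoc, div_mul_cancel₀ _ hc.ne'] at this
  exact ⟨key c d hc hd, key d c hd hc⟩

theorem fderiv_apply_fst_eq {g : ℂ × ℂ → ℂ} {w v d : ℂ} (hg : DifferentiableAt ℝ g (w, v))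
    (hd : HasDerivAt (fun w => g (w, v)) d w) (z : ℂ) : fderiv ℝ g (w, v) (z, 0) = d * z := by
  have h1 : HasFDerivAt (fun w : ℂ => (w, v))
      ((ContinuousLinearMap.id ℝ ℂ).prod (0 : ℂ →L[ℝ] ℂ)) w :=
    (hasFDerivAt_id w).prodMk (hasFDerivAt_const v w)
  have h2 := hg.hasFDerivAt.comp w h1
  have h3 := DFunLike.congr_fun (h2.unique hd.complexToReal_fderiv) z
  simpa using h3

/-- The absence of phase-critical points of the braid polynomial, read on `ℂ × S¹`: where `∂f/∂u`
vanishes, the phase of `f` moves along the circle `|v| = 1`. -/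
theorem NoPhaseCritical.im_fderiv_semiholMap_ne_zero {a b : ℝ} {s r ℓ : ℕ} (hs : 0 < s)
    (hcrit : NoPhaseCritical a b s r ℓ) {w v : ℂ} (hv : ‖v‖ = 1)
    (h0 : semiholMap a b s r ℓ (w, v) ≠ 0) (h' : semiholDeriv a b s r ℓ (w, v) = 0) :
    (conj (semiholMap a b s r ℓ (w, v))
      * fderiv ℝ (semiholMap a b s r ℓ) (w, v) (0, Complex.I * v)).im ≠ 0 := by
  obtain ⟨h, hh, rfl⟩ := exists_exp_eq hv
  intro him
  have hg : Differentiable ℝ (semiholMap a b s r ℓ) :=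
    (contDiff_semiholMap a b s r ℓ (m := 1)).differentiable one_ne_zero
  refine hcrit w h hh ((isPhaseCritical_iff (differentiable_braidPoly _ _ _ _ _ _)).2 ?_)
  rw [← semiholMap_exp a b s r ℓ hs]
  refine ⟨h0, fun y => ?_⟩
  have hE : HasFDerivAt (fun x : ℂ × ℝ => (x.1, Complex.exp ((x.2 : ℂ) * Complex.I)))
      ((ContinuousLinearMap.fst ℝ ℂ ℝ).prod
        ((ContinuousLinearMap.toSpanSingleton ℝ
          (Complex.I * Complex.exp ((h : ℂ) * Complex.I))).comp
          (ContinuousLinearMap.snd ℝ ℂ ℝ))) (w, h) := by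
    refine hasFDerivAt_fst.prodMk ?_
    have h1 : HasDerivAt (fun t : ℝ => Complex.exp ((t : ℂ) * Complex.I))
        (Complex.I * Complex.exp ((h : ℂ) * Complex.I)) h := by
      have := ((Complex.ofRealCLM.hasDerivAt (x := h)).mul_const Complex.I).cexp
      simpa [mul_comm] using! this
    exact HasFDerivAt.comp (f := fun x : ℂ × ℝ => x.2) (w, h) h1.hasFDerivAt hasFDerivAt_snd
  have hcomp := (hg (w, Complex.exp ((h : ℂ) * Complex.I))).hasFDerivAt.comp (w, h) hE
  have hfun : (semiholMap a b s r ℓ ∘ fun x : ℂ × ℝ => (x.1, Complex.exp ((x.2 : ℂ) * Complex.I)))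
      = braidPoly a b s r ℓ := by
    ext ⟨x, t⟩; exact semiholMap_exp a b s r ℓ hs x t
  rw [hfun] at hcomp
  rw [hcomp.fderiv]
  simp only [ContinuousLinearMap.comp_apply, ContinuousLinearMap.prod_apply,
    ContinuousLinearMap.toSpanSingleton_apply, ContinuousLinearMap.coe_fst',
    ContinuousLinearMap.coe_snd']
  have hsplit : (y.1, y.2 • (Complex.I * Complex.exp ((h : ℂ) * Complex.I)))
      = (y.1, (0 : ℂ)) + y.2 • ((0 : ℂ), Complex.I * Complex.exp ((h : ℂ) * Complex.I)) := by
    simp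
  rw [hsplit, map_add, map_smul, fderiv_apply_fst_eq (hg _) (hasDerivAt_semiholMap a b s r ℓ _ _), h', zero_mul,
      zero_add, Complex.real_smul,
    mul_left_comm, Complex.im_ofReal_mul, him, mul_zero]

/-! ### Phase regularity for small stretching factors -/

/-- On the rescaled sphere `λ²|w|² + |v|² = 1` the map `f` is phase-regular if `λ` is small. For
large `|w|` the phase moves along the circles `(e^{iτ} w, v)`. For bounded `|w|` the rescaled
spheres converge to `ℂ × S¹` as `λ → 0`, and a critical point would survive in the limit by
compactness. -/
theorem exists_phaseRegular_rescaled {g g' : ℂ × ℂ → ℂ} (hg : ContDiff ℝ 1 g)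
    (hd : ∀ w v, HasDerivAt (fun w => g (w, v)) (g' (w, v)) w)
    {M : ℝ} (hM : ∀ w v, ‖v‖ ≤ 1 → M ≤ ‖w‖ → 0 < (w * g' (w, v) * conj (g (w, v))).re)
    (hcrit : ∀ w v, ‖v‖ = 1 → g' (w, v) = 0 →
      (conj (g (w, v)) * fderiv ℝ g (w, v) (0, Complex.I * v)).im ≠ 0) :
    ∃ ε : ℝ, 0 < ε ∧ ∀ lam : ℝ, 0 < lam → lam < ε → ∀ w v ζ : ℂ,
      lam ^ 2 * ‖w‖ ^ 2 + ‖v‖ ^ 2 = 1 → ‖ζ‖ = 1 → (‖g (w, v)‖ : ℂ) * ζ = g (w, v) →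
      ∃ z y : ℂ, lam ^ 2 * inner ℝ w z + inner ℝ v y = 0 ∧
        (conj ζ * fderiv ℝ g (w, v) (z, y)).im ≠ 0 := by
  have hg1 : ∀ w v z, fderiv ℝ g (w, v) (z, 0) = g' (w, v) * z := fun w v z =>
    fderiv_apply_fst_eq ((hg.differentiable one_ne_zero) _) (hd w v) z
  have hDg : Continuous (fderiv ℝ g) := hg.continuous_fderiv one_ne_zero
  have hgc := hg.continuous
  have hDc : ∀ {Y : Type} [TopologicalSpace Y] {p d : Y → ℂ × ℂ} {ζ : Y → ℂ}, Continuous p →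
      Continuous d → Continuous ζ → Continuous fun y => (conj (ζ y) * fderiv ℝ g (p y) (d y)).im :=
    fun hp hd hζ => Complex.continuous_im.comp
      ((Complex.continuous_conj.comp hζ).mul ((hDg.comp hp).clm_apply hd))
  -- the set of failures with bounded `w`, including those with `λ = 0`
  set C : Set (ℝ × ℂ × ℂ × ℂ) :=
    (Set.Icc 0 1 ×ˢ Metric.closedBall 0 M ×ˢ Metric.closedBall 0 1 ×ˢ Metric.sphere 0 1) ∩
      ({p | p.1 ^ 2 * ‖p.2.1‖ ^ 2 + ‖p.2.2.1‖ ^ 2 = 1} ∩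
      {p | (‖g (p.2.1, p.2.2.1)‖ : ℂ) * p.2.2.2 = g (p.2.1, p.2.2.1)} ∩
      {p | (conj p.2.2.2 * fderiv ℝ g (p.2.1, p.2.2.1) (0, Complex.I * p.2.2.1)).im = 0} ∩
      ⋂ z : ℂ, {p | (conj p.2.2.2 * fderiv ℝ g (p.2.1, p.2.2.1)
        (((‖p.2.2.1‖ ^ 2 : ℝ) : ℂ) * z,
          ((-(p.1 ^ 2 * inner ℝ p.2.1 z) : ℝ) : ℂ) * p.2.2.1)).im = 0}) with hC
  have hCc : IsCompact C := by
    refine (isCompact_Icc.prod ((isCompact_closedBall _ _).prod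
      ((isCompact_closedBall _ _).prod (isCompact_sphere _ _)))).inter_right ?_
    refine (((isClosed_eq (by fun_prop) continuous_const).inter
      (isClosed_eq (by fun_prop) (by fun_prop))).inter
      (isClosed_eq (hDc (by fun_prop) (by fun_prop) (by fun_prop)) continuous_const)).inter
      (isClosed_iInter fun z => isClosed_eq (hDc (by fun_prop) (by fun_prop) (by fun_prop))
        continuous_const)
  have hCpos : ∀ p ∈ C, 0 < p.1 := by
    rintro ⟨lam, w, v, ζ⟩ ⟨⟨⟨hl, -⟩, -, -, hζ⟩, ⟨⟨hS, hgζ⟩, him⟩, hall⟩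
    refine lt_of_le_of_ne hl fun h0 => ?_
    simp only at h0
    subst h0
    have hv : ‖v‖ = 1 := by
      have h : (0 : ℝ) ^ 2 * ‖w‖ ^ 2 + ‖v‖ ^ 2 = 1 := hS
      rw [zero_pow two_ne_zero, zero_mul, zero_add] at h
      exact (pow_eq_one_iff_of_nonneg (norm_nonneg v) two_ne_zero).1 h
    have hζ' : (‖g (w, v)‖ : ℂ) * ζ = g (w, v) := hgζ
    have hall' : ∀ z, (conj ζ * (g' (w, v) * z)).im = 0 := fun z => by
      have h := Set.mem_iInter.1 hall z
      simpa [hv, hg1] using h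
    have h1 := hall' (Complex.I * conj (conj ζ * g' (w, v)))
    rw [← mul_assoc, mul_left_comm, Complex.mul_conj, Complex.I_mul_im, Complex.ofReal_re,
      Complex.normSq_eq_zero, mul_eq_zero] at h1
    have hζ0 : conj ζ ≠ 0 := by
      rw [map_ne_zero_iff _ (RingHom.injective _)]
      rintro rfl
      simp at hζ
    refine hcrit w v hv (h1.resolve_left hζ0) ?_
    rw [← hζ', map_mul, Complex.conj_ofReal, mul_assoc, Complex.im_ofReal_mul]
    exact mul_eq_zero_of_right _ him
  obtain ⟨ε₀, hε₀, hmin⟩ : ∃ ε : ℝ, 0 < ε ∧ ∀ p ∈ C, ε ≤ p.1 := by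
    rcases C.eq_empty_or_nonempty with h | h
    · exact ⟨1, one_pos, by simp [h]⟩
    · obtain ⟨p, hp, hmin⟩ := hCc.exists_isMinOn h continuous_fst.continuousOn
      exact ⟨_, hCpos p hp, fun x hx => hmin hx⟩
  refine ⟨min ε₀ 1, lt_min hε₀ one_pos, fun lam hlam0 hlam w v ζ hS hζ hgζ => ?_⟩
  by_contra hno
  push Not at hno
  have hv1 : ‖v‖ ≤ 1 := by nlinarith [norm_nonneg v, mul_nonneg (sq_nonneg lam) (sq_nonneg ‖w‖)]
  rcases le_or_gt M ‖w‖ with hw | hw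
  · have h1 := hno (Complex.I * w) 0 (by
      rw [inner_zero_right, add_zero, Complex.inner]
      have : Complex.I * w * conj w = Complex.I * (Complex.normSq w : ℂ) := by
        rw [mul_assoc, Complex.mul_conj]
      rw [this]; simp)
    rw [hg1, mul_left_comm (g' (w, v)), mul_left_comm, Complex.I_mul_im] at h1
    have h2 := hM w v hv1 hw
    have h3 : w * g' (w, v) * conj (g (w, v)) = (‖g (w, v)‖ : ℂ) * (conj ζ * (g' (w, v) * w)) := by
      conv_lhs => rw [← hgζ]
      rw [map_mul, Complex.conj_ofReal]
      ring
    rw [h3, Complex.re_ofReal_mul, h1, mul_zero] at h2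
    exact lt_irrefl _ h2
  · have hmem : (lam, w, v, ζ) ∈ C := by
      refine ⟨⟨⟨hlam0.le, (hlam.trans_le (min_le_right _ _)).le⟩, by simpa using hw.le,
        by simpa using hv1, by simpa using hζ⟩, ⟨⟨hS, hgζ⟩, ?_⟩, Set.mem_iInter.2 fun z => ?_⟩
      · refine hno 0 (Complex.I * v) ?_
        rw [inner_zero_right, mul_zero, zero_add, Complex.inner]
        have : Complex.I * v * conj v = Complex.I * (Complex.normSq v : ℂ) := by
          rw [mul_assoc, Complex.mul_conj]
        rw [this]; simp
      · refine hno _ _ ?_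
        rw [← Complex.real_smul, ← Complex.real_smul, real_inner_smul_right,
          real_inner_smul_right, real_inner_self_eq_norm_sq]
        ring
    exact absurd (hmin _ hmem) (not_le.2 (hlam.trans_le (min_le_left _ _)))

/-- For small stretching factors the map `f` is phase-regular on `S³`. -/
theorem NoPhaseCritical.exists_isPhaseRegularOnS3 {a b : ℝ} (ha : 0 < a) (hb : 0 < b) {s r ℓ : ℕ}
    (hs : 0 < s) (hℓ : 0 < ℓ) (hsℓ : Nat.Coprime s ℓ) (hcrit : NoPhaseCritical a b s r ℓ) :
    ∃ ε : ℝ, 0 < ε ∧ ∀ lam : ℝ, 0 < lam → lam < ε →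
      IsPhaseRegularOnS3 (semiholMap (lam * a) (lam * b) s r ℓ) := by
  obtain ⟨M, -, hM⟩ := exists_re_mul_semiholDeriv_pos a b r ℓ hs
  obtain ⟨ε, hε, h⟩ := exists_phaseRegular_rescaled (contDiff_semiholMap a b s r ℓ)
    (hasDerivAt_semiholMap a b s r ℓ) hM fun w v hv h' =>
      hcrit.im_fderiv_semiholMap_ne_zero hs hv
        (fun h0 => semiholDeriv_ne_zero ha hb r hs hℓ hsℓ hv h0 h') h'
  refine ⟨ε, hε, fun lam h0 hlam q hq ζ hζ hF => ?_⟩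
  have hlam0 : (lam : ℂ) ≠ 0 := by exact_mod_cast h0.ne'
  obtain ⟨u, v⟩ := q
  obtain ⟨w, rfl⟩ : ∃ w, u = lam * w := ⟨u / lam, (mul_div_cancel₀ _ hlam0).symm⟩
  rw [semiholMap_smul, norm_mul, norm_pow, Complex.norm_real, Real.norm_of_nonneg h0.le,
    Complex.ofReal_mul, Complex.ofReal_pow, mul_assoc] at hF
  have hS : lam ^ 2 * ‖w‖ ^ 2 + ‖v‖ ^ 2 = 1 := by
    have : ‖(lam : ℂ) * w‖ ^ 2 + ‖v‖ ^ 2 = 1 := hq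
    rwa [norm_mul, Complex.norm_real, Real.norm_of_nonneg h0.le, mul_pow] at this
  obtain ⟨z, y, hzy, hne⟩ := h lam h0 hlam w v ζ hS hζ (mul_left_cancel₀ (pow_ne_zero _ hlam0) hF)
  refine ⟨(lam * z, y), ?_, ?_⟩
  · rw [realInner]
    simp only
    rw [← Complex.real_smul, ← Complex.real_smul, real_inner_smul_left, real_inner_smul_right,
      ← mul_assoc, ← sq, hzy]
  · have hd : HasFDerivAt (fun x : ℂ × ℂ => ((lam : ℂ) * x.1, x.2))
        (((lam : ℂ) • ContinuousLinearMap.fst ℝ ℂ ℂ).prod (ContinuousLinearMap.snd ℝ ℂ ℂ)) (w, v) :=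
      (hasFDerivAt_fst.const_mul (lam : ℂ)).prodMk hasFDerivAt_snd
    have hdiff : ∀ a b, Differentiable ℝ (semiholMap a b s r ℓ) := fun a b =>
      (contDiff_semiholMap a b s r ℓ (m := 1)).differentiable one_ne_zero
    have h2 := (hdiff (lam * a) (lam * b) ((lam : ℂ) * w, v)).hasFDerivAt.comp (w, v) hd
    have h3 : HasFDerivAt (fun x : ℂ × ℂ => (lam : ℂ) ^ s * semiholMap a b s r ℓ x)
        ((lam : ℂ) ^ s • fderiv ℝ (semiholMap a b s r ℓ) (w, v)) (w, v) :=
      (hdiff a b (w, v)).hasFDerivAt.const_mul _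
    have h4 : (semiholMap (lam * a) (lam * b) s r ℓ ∘ fun x : ℂ × ℂ => ((lam : ℂ) * x.1, x.2))
        = fun x : ℂ × ℂ => (lam : ℂ) ^ s * semiholMap a b s r ℓ x := by
      ext ⟨x, y⟩; exact semiholMap_smul lam a b s r ℓ x y
    rw [h4] at h2
    have h6 := DFunLike.congr_fun (h2.unique h3) (z, y)
    simp only [ContinuousLinearMap.comp_apply, ContinuousLinearMap.prod_apply,
      _root_.smul_apply, ContinuousLinearMap.coe_fst', ContinuousLinearMap.coe_snd',
      smul_eq_mul] at h6
    rw [h6, mul_left_comm, ← Complex.ofReal_pow, Complex.im_ofReal_mul]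
    exact mul_ne_zero (pow_ne_zero _ h0.ne') hne

/-! ### Cut-off displacements near finitely many points -/

/-- The piecewise linear cut-off function that is `1` on `(-∞, δ/2]` and `0` on `[δ, ∞)`. -/
def cutoff (δ t : ℝ) : ℝ := max 0 (min 1 (2 - 2 / δ * t))

theorem cutoff_nonneg (δ t : ℝ) : 0 ≤ cutoff δ t := le_max_left _ _

theorem cutoff_le_one (δ t : ℝ) : cutoff δ t ≤ 1 := max_le zero_le_one (min_le_left _ _)

theorem cutoff_eq_one {δ t : ℝ} (hδ : 0 < δ) (ht : t ≤ δ / 2) : cutoff δ t = 1 := by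
  have h : 2 / δ * t ≤ 1 := by
    calc 2 / δ * t ≤ 2 / δ * (δ / 2) := by gcongr
      _ = 1 := by field_simp
  rw [cutoff, min_eq_left (by linarith), max_eq_right zero_le_one]

theorem cutoff_eq_zero {δ t : ℝ} (hδ : 0 < δ) (ht : δ ≤ t) : cutoff δ t = 0 := by
  have h : 2 ≤ 2 / δ * t := by
    calc 2 = 2 / δ * δ := by field_simp
      _ ≤ 2 / δ * t := by gcongr
  exact max_eq_left ((min_le_right _ _).trans (by linarith))

theorem continuous_cutoff (δ : ℝ) : Continuous (cutoff δ) := by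
  unfold cutoff; fun_prop

theorem abs_cutoff_sub_le {δ : ℝ} (hδ : 0 < δ) (t t' : ℝ) :
    |cutoff δ t - cutoff δ t'| ≤ 2 / δ * |t - t'| := by
  have h1 : |cutoff δ t - cutoff δ t'| ≤ |min 1 (2 - 2 / δ * t) - min 1 (2 - 2 / δ * t')| :=
    (abs_max_sub_max_le_max _ _ _ _).trans (by simp)
  have h2 : |min 1 (2 - 2 / δ * t) - min 1 (2 - 2 / δ * t')|
      ≤ |(2 - 2 / δ * t) - (2 - 2 / δ * t')| :=
    (abs_min_sub_min_le_max _ _ _ _).trans (by simp)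
  refine (h1.trans h2).trans (le_of_eq ?_)
  rw [sub_sub_sub_cancel_left, ← mul_sub, abs_mul, abs_of_pos (by positivity : 0 < 2 / δ),
    abs_sub_comm]

/-- The sum of the displacements `e j`, each cut off to the `δ`-ball around `z j`. -/
def cutoffSum (s : ℕ) (δ : ℝ) (z : ℕ → ℂ) (e : ℕ → ℂ → ℂ) (w : ℂ) : ℂ :=
  ∑ j ∈ Finset.range s, (cutoff δ ‖w - z j‖ : ℂ) * e j w

theorem norm_cutoff_mul_le {δ κ : ℝ} (hδ : 0 < δ) (hκ : 0 ≤ κ) {z : ℂ} {e : ℂ → ℂ}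
    (hlip : ∀ w w', ‖w - z‖ ≤ δ → ‖w' - z‖ ≤ δ → ‖e w - e w'‖ ≤ κ * ‖w - w'‖)
    (hz : ‖e z‖ ≤ κ * δ) (w : ℂ) : ‖(cutoff δ ‖w - z‖ : ℂ) * e w‖ ≤ 2 * κ * δ := by
  rw [norm_mul, Complex.norm_real, Real.norm_of_nonneg (cutoff_nonneg _ _)]
  rcases le_or_gt ‖w - z‖ δ with h | h
  · have h1 := hlip w z h (by simpa using hδ.le)
    have h2 : ‖e w‖ ≤ 2 * κ * δ := by
      calc ‖e w‖ ≤ ‖e w - e z‖ + ‖e z‖ := by simpa using norm_add_le (e w - e z) (e z)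
        _ ≤ κ * δ + κ * δ := by gcongr; exact h1.trans (by gcongr)
        _ = _ := by ring
    exact (mul_le_of_le_one_left (norm_nonneg _) (cutoff_le_one _ _)).trans h2
  · rw [cutoff_eq_zero hδ h.le, zero_mul]
    positivity

theorem norm_cutoff_mul_sub_le {δ κ : ℝ} (hδ : 0 < δ) (hκ : 0 ≤ κ) {z : ℂ} {e : ℂ → ℂ}
    (hlip : ∀ w w', ‖w - z‖ ≤ δ → ‖w' - z‖ ≤ δ → ‖e w - e w'‖ ≤ κ * ‖w - w'‖)
    (hz : ‖e z‖ ≤ κ * δ) (w w' : ℂ) :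
    ‖(cutoff δ ‖w - z‖ : ℂ) * e w - (cutoff δ ‖w' - z‖ : ℂ) * e w'‖ ≤ 5 * κ * ‖w - w'‖ := by
  have hbound : ∀ w, ‖w - z‖ ≤ δ → ‖e w‖ ≤ 2 * κ * δ := fun w h => by
    have h1 := hlip w z h (by simpa using hδ.le)
    calc ‖e w‖ ≤ ‖e w - e z‖ + ‖e z‖ := by simpa using norm_add_le (e w - e z) (e z)
      _ ≤ κ * δ + κ * δ := by gcongr; exact h1.trans (by gcongr)
      _ = _ := by ring
  have hcut : ∀ w w' : ℂ, |cutoff δ ‖w - z‖ - cutoff δ ‖w' - z‖| ≤ 2 / δ * ‖w - w'‖ := fun w w' => by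
    refine (abs_cutoff_sub_le hδ _ _).trans ?_
    gcongr
    simpa using abs_norm_sub_norm_le (w - z) (w' - z)
  -- it suffices to treat the case that `w'` lies in the ball
  have key : ∀ w w', ‖w' - z‖ ≤ δ →
      ‖(cutoff δ ‖w - z‖ : ℂ) * e w - (cutoff δ ‖w' - z‖ : ℂ) * e w'‖ ≤ 5 * κ * ‖w - w'‖ := by
    intro w w' h'
    have hprod : ‖((cutoff δ ‖w - z‖ - cutoff δ ‖w' - z‖ : ℝ) : ℂ) * e w'‖ ≤ 4 * κ * ‖w - w'‖ := by
      rw [norm_mul, Complex.norm_real, Real.norm_eq_abs]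
      calc _ ≤ (2 / δ * ‖w - w'‖) * (2 * κ * δ) := by gcongr; exacts [hcut w w', hbound w' h']
        _ = _ := by field_simp; ring
    rcases le_or_gt ‖w - z‖ δ with h | h
    · have e1 : (cutoff δ ‖w - z‖ : ℂ) * e w - (cutoff δ ‖w' - z‖ : ℂ) * e w'
          = (cutoff δ ‖w - z‖ : ℂ) * (e w - e w')
            + ((cutoff δ ‖w - z‖ - cutoff δ ‖w' - z‖ : ℝ) : ℂ) * e w' := by push_cast; ring
      rw [e1]
      refine (norm_add_le _ _).trans ?_
      have h2 : ‖(cutoff δ ‖w - z‖ : ℂ) * (e w - e w')‖ ≤ κ * ‖w - w'‖ := by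
        rw [norm_mul, Complex.norm_real, Real.norm_of_nonneg (cutoff_nonneg _ _)]
        exact (mul_le_of_le_one_left (norm_nonneg _) (cutoff_le_one _ _)).trans (hlip w w' h h')
      linarith
    · rw [cutoff_eq_zero hδ h.le] at hprod ⊢
      rw [zero_sub, Complex.ofReal_neg, neg_mul, norm_neg] at hprod
      rw [Complex.ofReal_zero, zero_mul, zero_sub, norm_neg]
      have : 0 ≤ κ * ‖w - w'‖ := by positivity
      linarith
  rcases le_or_gt ‖w' - z‖ δ with h' | h'
  · exact key w w' h'
  · rcases le_or_gt ‖w - z‖ δ with h | h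
    · rw [norm_sub_rev, norm_sub_rev w w']; exact key w' w h
    · rw [cutoff_eq_zero hδ h.le, cutoff_eq_zero hδ h'.le]
      simp only [Complex.ofReal_zero, zero_mul, sub_self, norm_zero]
      positivity

section CutoffSum

variable {s : ℕ} {δ κ : ℝ} {z : ℕ → ℂ} {e : ℕ → ℂ → ℂ}

theorem lipschitzWith_cutoffSum (hδ : 0 < δ) (hκ : 0 ≤ κ) (hsκ : 10 * s * κ ≤ 1)
    (hlip : ∀ j < s, ∀ w w', ‖w - z j‖ ≤ δ → ‖w' - z j‖ ≤ δ → ‖e j w - e j w'‖ ≤ κ * ‖w - w'‖)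
    (hz : ∀ j < s, ‖e j (z j)‖ ≤ κ * δ) : LipschitzWith (1 / 2) (cutoffSum s δ z e) := by
  refine LipschitzWith.of_dist_le_mul fun w w' => ?_
  rw [dist_eq_norm, dist_eq_norm, cutoffSum, cutoffSum, ← Finset.sum_sub_distrib]
  calc _ ≤ ∑ j ∈ Finset.range s, 5 * κ * ‖w - w'‖ := norm_sum_le_of_le _ fun j hj =>
        norm_cutoff_mul_sub_le hδ hκ (hlip j (Finset.mem_range.1 hj)) (hz j (Finset.mem_range.1 hj)) _ _
    _ = (10 * s * κ) / 2 * ‖w - w'‖ := by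
        rw [Finset.sum_const, Finset.card_range, nsmul_eq_mul]; ring
    _ ≤ 1 / 2 * ‖w - w'‖ := by gcongr
    _ = _ := by push_cast; ring

theorem norm_cutoffSum_le (hδ : 0 < δ) (hκ : 0 ≤ κ) (hsκ : 10 * s * κ ≤ 1)
    (hlip : ∀ j < s, ∀ w w', ‖w - z j‖ ≤ δ → ‖w' - z j‖ ≤ δ → ‖e j w - e j w'‖ ≤ κ * ‖w - w'‖)
    (hz : ∀ j < s, ‖e j (z j)‖ ≤ κ * δ) (w : ℂ) : ‖cutoffSum s δ z e w‖ ≤ δ / 2 := by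
  calc _ ≤ ∑ j ∈ Finset.range s, 2 * κ * δ := norm_sum_le_of_le _ fun j hj =>
        norm_cutoff_mul_le hδ hκ (hlip j (Finset.mem_range.1 hj)) (hz j (Finset.mem_range.1 hj)) _
    _ = (10 * s * κ) / 5 * δ := by
        rw [Finset.sum_const, Finset.card_range, nsmul_eq_mul]; ring
    _ ≤ 1 / 5 * δ := by gcongr
    _ ≤ _ := by linarith

theorem cutoffSum_eq_zero (hδ : 0 < δ) {w : ℂ} (hw : ∀ j < s, δ ≤ ‖w - z j‖) :
    cutoffSum s δ z e w = 0 :=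
  Finset.sum_eq_zero fun j hj => by
    rw [cutoff_eq_zero hδ (hw j (Finset.mem_range.1 hj)), Complex.ofReal_zero, zero_mul]

theorem cutoffSum_eq (hδ : 0 < δ)
    (hsep : ∀ j < s, ∀ k < s, j ≠ k → 2 * δ ≤ ‖z j - z k‖) {j : ℕ} (hj : j < s) {w : ℂ}
    (hw : ‖w - z j‖ ≤ δ / 2) : cutoffSum s δ z e w = e j w := by
  rw [cutoffSum, Finset.sum_eq_single_of_mem j (Finset.mem_range.2 hj), cutoff_eq_one hδ hw,
    Complex.ofReal_one, one_mul]
  intro k hk hkj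
  have h1 := hsep j hj k (Finset.mem_range.1 hk) hkj.symm
  have h2 : ‖z j - z k‖ ≤ ‖w - z k‖ + ‖w - z j‖ := by
    rw [← sub_sub_sub_cancel_left _ _ w, norm_sub_rev]
    exact (norm_sub_le _ _).trans (add_comm _ _).le
  rw [cutoff_eq_zero hδ (by linarith), Complex.ofReal_zero, zero_mul]

end CutoffSum

/-! ### Moving the zeros of the perturbed polynomial to the roots -/

/-- The displacement `w ↦ z - w + g (w, √(1 - λ²|w|²) c) / g' (z, c)`. Near a simple root `z` of
`g (·, c)` and for small `λ` it is `C¹`-small, and `w` plus its displacement is `z` precisely when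
`w` is a zero of `w ↦ g (w, √(1 - λ²|w|²) c)`. -/
def rootShift (g g' : ℂ × ℂ → ℂ) (lam : ℝ) (z c w : ℂ) : ℂ :=
  z - w + g (w, (√(1 - lam ^ 2 * ‖w‖ ^ 2) : ℂ) * c) / g' (z, c)

theorem contDiffAt_rootShift {g g' : ℂ × ℂ → ℂ} (hg : ContDiff ℝ 1 g) (hg' : ContDiff ℝ 1 g')
    {z c : ℂ} (hzc : g' (z, c) ≠ 0) :
    ContDiffAt ℝ 1 (fun p : (ℝ × ℂ × ℂ) × ℂ => rootShift g g' p.1.1 p.1.2.1 p.1.2.2 p.2)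
      ((0, z, c), z) := by
  have h1 : ContDiffAt ℝ 1 (fun p : (ℝ × ℂ × ℂ) × ℂ => (√(1 - p.1.1 ^ 2 * ‖p.2‖ ^ 2) : ℂ))
      ((0, z, c), z) := by
    refine Complex.ofRealCLM.contDiff.contDiffAt.comp _ (ContDiffAt.sqrt ?_ (by simp))
    exact (contDiff_const.sub ((contDiff_fst.fst.pow 2).mul
      (contDiff_snd.norm_sq ℝ))).contDiffAt
  have h2 : ContDiffAt ℝ 1 (fun p : (ℝ × ℂ × ℂ) × ℂ =>
      g (p.2, (√(1 - p.1.1 ^ 2 * ‖p.2‖ ^ 2) : ℂ) * p.1.2.2)) ((0, z, c), z) :=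
    hg.contDiffAt.comp _ (contDiffAt_snd.prodMk (h1.mul contDiff_fst.snd.snd.contDiffAt))
  have h3 : ContDiffAt ℝ 1 (fun p : (ℝ × ℂ × ℂ) × ℂ => g' (p.1.2.1, p.1.2.2)) ((0, z, c), z) :=
    (hg'.comp (contDiff_fst.snd.fst.prodMk contDiff_fst.snd.snd)).contDiffAt
  simp only [rootShift, div_eq_mul_inv]
  exact (contDiff_fst.snd.fst.sub contDiff_snd).contDiffAt.add (h2.mul (h3.inv hzc))

theorem rootShift_zero (g g' : ℂ × ℂ → ℂ) (z c w : ℂ) :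
    rootShift g g' 0 z c w = z - w + g (w, c) / g' (z, c) := by
  simp [rootShift]

theorem fderiv_rootShift_apply {g g' : ℂ × ℂ → ℂ} (hg : ContDiff ℝ 1 g) (hg' : ContDiff ℝ 1 g')
    (hd : ∀ w v, HasDerivAt (fun w => g (w, v)) (g' (w, v)) w) {z c : ℂ} (hzc : g' (z, c) ≠ 0)
    (ξ : ℂ) : fderiv ℝ (fun p : (ℝ × ℂ × ℂ) × ℂ => rootShift g g' p.1.1 p.1.2.1 p.1.2.2 p.2)
      ((0, z, c), z) (0, ξ) = 0 := by
  have h1 : HasFDerivAt (fun w : ℂ => (((0 : ℝ), z, c), w))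
      ((0 : ℂ →L[ℝ] ℝ × ℂ × ℂ).prod (ContinuousLinearMap.id ℝ ℂ)) z :=
    (hasFDerivAt_const _ z).prodMk (hasFDerivAt_id z)
  have h2 := ((contDiffAt_rootShift hg hg' hzc).differentiableAt
    one_ne_zero).hasFDerivAt.comp z h1
  have h3 : HasDerivAt (fun w => rootShift g g' 0 z c w) 0 z := by
    simp only [rootShift_zero]
    have := ((hasDerivAt_id z).const_sub z).add ((hd z c).div_const (g' (z, c)))
    rw [div_self hzc, neg_add_cancel] at this
    exact this
  have h4 := DFunLike.congr_fun (h2.unique h3.complexToReal_fderiv) ξ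
  simpa using h4

/-- The displacement `rootShift` is a contraction with arbitrarily small constant near the simple
roots, uniformly for small `λ`: it has zero derivative in `w` at the roots for `λ = 0`, and the pairs
of a point `c` of the circle and a root over it form a compact set. -/
theorem exists_rootShift_lipschitz {g g' : ℂ × ℂ → ℂ} (hg : ContDiff ℝ 1 g) (hg' : ContDiff ℝ 1 g')
    (hd : ∀ w v, HasDerivAt (fun w => g (w, v)) (g' (w, v)) w) {R : Set (ℂ × ℂ)} (hR : IsCompact R)
    (hR' : ∀ p ∈ R, g' p ≠ 0) {κ : ℝ} (hκ : 0 < κ) :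
    ∃ δ : ℝ, 0 < δ ∧ ∀ lam : ℝ, |lam| < δ → ∀ z c, (z, c) ∈ R → ∀ w w', ‖w - z‖ < δ →
      ‖w' - z‖ < δ → ‖rootShift g g' lam z c w - rootShift g g' lam z c w'‖ ≤ κ * ‖w - w'‖ := by
  have hev := hR.eventually_forall_of_forall_eventually (x₀ := ((0 : ℝ), (0 : ℂ), (0 : ℂ)))
    (P := fun x y => ‖rootShift g g' x.1 y.1 y.2 (y.1 + x.2.1)
      - rootShift g g' x.1 y.1 y.2 (y.1 + x.2.2)‖ ≤ κ * ‖x.2.1 - x.2.2‖) (by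
    rintro ⟨z, c⟩ hzc
    have hst := ((contDiffAt_rootShift hg hg' (hR' _ hzc)).hasStrictFDerivAt
      one_ne_zero).isLittleO.def hκ
    have ht : Filter.Tendsto (fun q : (ℝ × ℂ × ℂ) × (ℂ × ℂ) =>
        (((q.1.1, q.2.1, q.2.2), q.2.1 + q.1.2.1), ((q.1.1, q.2.1, q.2.2), q.2.1 + q.1.2.2)))
        (𝓝 ((0, 0, 0), (z, c))) (𝓝 ((((0 : ℝ), z, c), z), ((0, z, c), z))) := by
      have : Continuous (fun q : (ℝ × ℂ × ℂ) × (ℂ × ℂ) =>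
        (((q.1.1, q.2.1, q.2.2), q.2.1 + q.1.2.1), ((q.1.1, q.2.1, q.2.2), q.2.1 + q.1.2.2))) := by
        fun_prop
      have h := this.tendsto ((0, 0, 0), (z, c))
      simpa using h
    filter_upwards [ht.eventually hst] with q hq
    have e : (((q.1.1, q.2.1, q.2.2), q.2.1 + q.1.2.1) : (ℝ × ℂ × ℂ) × ℂ)
        - ((q.1.1, q.2.1, q.2.2), q.2.1 + q.1.2.2) = (0, q.1.2.1 - q.1.2.2) := by simp
    rw [e, fderiv_rootShift_apply hg hg' hd (hR' _ hzc), sub_zero] at hq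
    simpa [Prod.norm_def] using hq)
  obtain ⟨δ, hδ, hball⟩ := Metric.eventually_nhds_iff.1 hev
  refine ⟨δ, hδ, fun lam hl z c hzc w w' hw hw' => ?_⟩
  have h := hball (y := (lam, w - z, w' - z)) (by
    simp only [Prod.dist_eq, dist_zero_right, max_lt_iff]
    exact ⟨hl, hw, hw'⟩) (z, c) hzc
  simpa using h

theorem exists_norm_rootShift_self_lt {g g' : ℂ × ℂ → ℂ} (hg : ContDiff ℝ 1 g)
    (hg' : ContDiff ℝ 1 g') {R : Set (ℂ × ℂ)} (hR : IsCompact R) (hR' : ∀ p ∈ R, g' p ≠ 0)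
    (hR0 : ∀ p ∈ R, g p = 0) {η : ℝ} (hη : 0 < η) :
    ∃ δ : ℝ, 0 < δ ∧ ∀ lam : ℝ, |lam| < δ → ∀ z c, (z, c) ∈ R →
      ‖rootShift g g' lam z c z‖ < η := by
  have hev := hR.eventually_forall_of_forall_eventually (x₀ := (0 : ℝ))
    (P := fun x y => ‖rootShift g g' x y.1 y.2 y.1‖ < η) (by
    rintro ⟨z, c⟩ hzc
    have h1 : ContinuousAt (fun q : ℝ × (ℂ × ℂ) => rootShift g g' q.1 q.2.1 q.2.2 q.2.1)
        (0, (z, c)) :=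
      ContinuousAt.comp (x := ((0 : ℝ), (z, c)))
        (g := fun p : (ℝ × ℂ × ℂ) × ℂ => rootShift g g' p.1.1 p.1.2.1 p.1.2.2 p.2)
        (f := fun q : ℝ × (ℂ × ℂ) => ((q.1, q.2.1, q.2.2), q.2.1))
        (contDiffAt_rootShift hg hg' (hR' _ hzc)).continuousAt (by fun_prop)
    refine h1.norm.eventually_lt continuousAt_const ?_
    simpa [rootShift_zero, hR0 _ hzc] using hη)
  obtain ⟨δ, hδ, hball⟩ := Metric.eventually_nhds_iff.1 hev
  exact ⟨δ, hδ, fun lam hl z c hzc => hball (by simpa using hl) (z, c) hzc⟩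

theorem exists_norm_perturbed_sub_lt {g : ℂ × ℂ → ℂ} (hg : Continuous g) (M : ℝ) {η : ℝ}
    (hη : 0 < η) : ∃ δ : ℝ, 0 < δ ∧ ∀ lam : ℝ, |lam| < δ → ∀ w c : ℂ, ‖w‖ ≤ M → ‖c‖ = 1 →
      ‖g (w, (√(1 - lam ^ 2 * ‖w‖ ^ 2) : ℂ) * c) - g (w, c)‖ < η := by
  have hev := ((isCompact_closedBall (0 : ℂ) M).prod
    (isCompact_sphere (0 : ℂ) 1)).eventually_forall_of_forall_eventually (x₀ := (0 : ℝ))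
    (P := fun x y => ‖g (y.1, (√(1 - x ^ 2 * ‖y.1‖ ^ 2) : ℂ) * y.2) - g (y.1, y.2)‖ < η) (by
    rintro ⟨w, c⟩ -
    have h1 : Continuous (fun q : ℝ × (ℂ × ℂ) =>
        ‖g (q.2.1, (√(1 - q.1 ^ 2 * ‖q.2.1‖ ^ 2) : ℂ) * q.2.2) - g (q.2.1, q.2.2)‖) := by
      fun_prop
    refine h1.continuousAt.eventually_lt continuousAt_const ?_
    simpa using hη)
  obtain ⟨δ, hδ, hball⟩ := Metric.eventually_nhds_iff.1 hev
  exact ⟨δ, hδ, fun lam hl w c hw hc => hball (by simpa using hl) (w, c)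
    ⟨by simpa using hw, by simpa using hc⟩⟩

/-! ### The nodal set is isotopic to the lemniscate link -/

/-- A `2π`-periodic continuous function of an angle is a continuous function on the circle. -/
theorem continuousAt_comp_arg {X E : Type*} [TopologicalSpace X] [TopologicalSpace E]
    {ψ : X × ℝ → E} (hψ : Continuous ψ) (hper : ∀ x h, ψ (x, h + 2 * Real.pi) = ψ (x, h))
    (x₀ : X) {c₀ : ℂ} (hc₀ : c₀ ≠ 0) :
    ContinuousAt (fun p : X × ℂ => ψ (p.1, Complex.arg p.2)) (x₀, c₀) := by
  -- a branch of the angle near `c₀`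
  have h1 : ContinuousAt (fun p : X × ℂ => ψ (p.1, Complex.arg (p.2 / c₀) + Complex.arg c₀))
      (x₀, c₀) := by
    refine hψ.continuousAt.comp (continuousAt_fst.prodMk (ContinuousAt.add ?_ continuousAt_const))
    refine ContinuousAt.comp (x := (x₀, c₀)) (g := Complex.arg) (f := fun p : X × ℂ => p.2 / c₀)
      (Complex.continuousAt_arg ?_) (by fun_prop)
    simp [div_self hc₀]
  refine h1.congr ?_
  have hev : ∀ᶠ p : X × ℂ in 𝓝 (x₀, c₀), p.2 ≠ 0 :=
    ContinuousAt.eventually_ne continuousAt_snd hc₀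
  filter_upwards [hev] with p hp
  have hangle : ((Complex.arg (p.2 / c₀) + Complex.arg c₀ : ℝ) : Real.Angle) = Complex.arg p.2 := by
    rw [Real.Angle.coe_add, Complex.arg_div_coe_angle hp hc₀, sub_add_cancel]
  obtain ⟨k, hk⟩ := Real.Angle.angle_eq_iff_two_pi_dvd_sub.1 hangle
  have hP : Function.Periodic (fun h => ψ (p.1, h)) (2 * Real.pi) := hper p.1
  have h2 := hP.int_mul k (Complex.arg p.2)
  rw [show Complex.arg (p.2 / c₀) + Complex.arg c₀ = Complex.arg p.2 + k * (2 * Real.pi) by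
    linarith]
  exact h2

theorem semiholMap_strand (a b : ℝ) {s : ℕ} (r ℓ : ℕ) (hs : 0 < s) {j : ℕ} (hj : j < s) (h : ℝ) :
    semiholMap a b s r ℓ (strand a b s r ℓ j h, Complex.exp (h * Complex.I)) = 0 := by
  rw [semiholMap_exp a b s r ℓ hs, braidPoly]
  exact Finset.prod_eq_zero (Finset.mem_range.2 hj) (sub_self _)

theorem exists_eq_strand (a b : ℝ) {s : ℕ} (r ℓ : ℕ) (hs : 0 < s) {z : ℂ} {h : ℝ}
    (hz : semiholMap a b s r ℓ (z, Complex.exp (h * Complex.I)) = 0) :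
    ∃ j < s, z = strand a b s r ℓ j h := by
  rw [semiholMap_exp a b s r ℓ hs, braidPoly, Finset.prod_eq_zero_iff] at hz
  obtain ⟨j, hj, hzj⟩ := hz
  exact ⟨j, Finset.mem_range.1 hj, sub_eq_zero.1 hzj⟩

/-- A point at which the monic polynomial `f (·, e^{ih})` is small is close to one of its roots. -/
theorem exists_norm_sub_strand_le (a b : ℝ) {s : ℕ} (r ℓ : ℕ) (hs : 0 < s) {η : ℝ} (hη : 0 ≤ η)
    {w : ℂ} {h : ℝ} (hw : ‖semiholMap a b s r ℓ (w, Complex.exp (h * Complex.I))‖ < η ^ s) :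
    ∃ j < s, ‖w - strand a b s r ℓ j h‖ ≤ η := by
  by_contra! hno
  rw [semiholMap_exp a b s r ℓ hs, braidPoly, norm_prod] at hw
  refine absurd hw (not_lt.2 ?_)
  calc η ^ s = ∏ j ∈ Finset.range s, η := by rw [Finset.prod_const, Finset.card_range]
    _ ≤ _ := Finset.prod_le_prod (fun _ _ => hη) fun j hj => (hno j (Finset.mem_range.1 hj)).le

/-- For small `λ` there is a periodic family `D` of displacements that moves the zeros of
`w ↦ f (w, √(1 - λ²|w|²) e^{ih})` with `|w| ≤ M` precisely onto the roots of `f (·, e^{ih})`. It is the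
cut-off of `rootShift` to disjoint balls around the roots. -/
theorem exists_displacement {a b : ℝ} (ha : 0 < a) (hb : 0 < b) {s ℓ : ℕ} (r : ℕ)
    (hs : 0 < s) (hℓ : 0 < ℓ) (hsℓ : Nat.Coprime s ℓ) {M : ℝ}
    (hroot : ∀ w v, ‖v‖ ≤ 1 → semiholMap a b s r ℓ (w, v) = 0 → ‖w‖ < M) :
    ∃ ε : ℝ, 0 < ε ∧ ∀ lam : ℝ, 0 < lam → lam < ε → ∃ D : ℝ → ℂ → ℂ,
      (∀ h, LipschitzWith (1 / 2) (D h)) ∧ (Continuous fun p : ℂ × ℝ => D p.2 p.1) ∧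
      (∀ h w, D (h + 2 * Real.pi) w = D h w) ∧ (∀ h w, M + 1 ≤ ‖w‖ → D h w = 0) ∧
      (∀ (h : ℝ) w, ‖w‖ ≤ M → semiholMap a b s r ℓ
          (w, (√(1 - lam ^ 2 * ‖w‖ ^ 2) : ℂ) * Complex.exp (h * Complex.I)) = 0 →
        ∃ j < s, w + D h w = strand a b s r ℓ j h) ∧
      (∀ (h : ℝ) w, ∀ j < s, w + D h w = strand a b s r ℓ j h → semiholMap a b s r ℓ
          (w, (√(1 - lam ^ 2 * ‖w‖ ^ 2) : ℂ) * Complex.exp (h * Complex.I)) = 0) := by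
  set g := semiholMap a b s r ℓ with hg
  set g' := semiholDeriv a b s r ℓ with hg'
  set Z : ℕ → ℝ → ℂ := strand a b s r ℓ with hZ
  have hgC : ContDiff ℝ 1 g := contDiff_semiholMap a b s r ℓ
  have hgC' : ContDiff ℝ 1 g' := contDiff_semiholDeriv a b s r ℓ
  set R : Set (ℂ × ℂ) := (Metric.closedBall 0 M ×ˢ Metric.sphere 0 1) ∩ {p | g p = 0} with hR
  have hRc : IsCompact R := ((isCompact_closedBall _ _).prod (isCompact_sphere _ _)).inter_right
    (isClosed_eq hgC.continuous continuous_const)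
  have hR' : ∀ p ∈ R, g' p ≠ 0 := by
    rintro ⟨w, c⟩ ⟨⟨-, hc⟩, h0⟩
    exact semiholDeriv_ne_zero ha hb r hs hℓ hsℓ (by simpa using hc) h0
  have hR0 : ∀ p ∈ R, g p = 0 := fun p hp => hp.2
  have hexp1 : ∀ h : ℝ, ‖Complex.exp (h * Complex.I)‖ = 1 := Complex.norm_exp_ofReal_mul_I
  have hZM : ∀ j < s, ∀ h, ‖Z j h‖ < M := fun j hj h =>
    hroot _ _ (hexp1 h).le (semiholMap_strand a b r ℓ hs hj h)
  have hZR : ∀ j < s, ∀ h : ℝ, (Z j h, Complex.exp (h * Complex.I)) ∈ R := fun j hj h =>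
    ⟨⟨by simpa using (hZM j hj h).le, by simp⟩, semiholMap_strand a b r ℓ hs hj h⟩
  have hs1 : (1 : ℝ) ≤ s := by exact_mod_cast hs
  set κ : ℝ := 1 / (10 * s) with hκ
  have hκ0 : 0 < κ := by positivity
  have hsκ : 10 * s * κ ≤ 1 := by rw [hκ, mul_one_div_cancel (by positivity)]
  have hκ1 : κ < 1 := by rw [hκ, div_lt_one (by positivity)]; linarith
  obtain ⟨δ₁, hδ₁, hlip⟩ := exists_rootShift_lipschitz hgC hgC'
    (hasDerivAt_semiholMap a b s r ℓ) hRc hR' hκ0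
  set δ : ℝ := min (δ₁ / 3) 1 with hδdef
  have hδ : 0 < δ := lt_min (by positivity) one_pos
  have hδ1 : δ ≤ 1 := min_le_right _ _
  have hδδ₁ : 2 * δ < δ₁ := by linarith [min_le_left (δ₁ / 3) 1]
  have hsep : ∀ h, ∀ j < s, ∀ k < s, j ≠ k → 2 * δ ≤ ‖Z j h - Z k h‖ := by
    intro h j hj k hk hjk
    by_contra hlt
    have hne := strand_ne ha hb r hs hℓ hsℓ hj hk hjk h
    have h1 := hlip 0 (by simpa using hδ₁) _ _ (hZR j hj h) (Z j h) (Z k h) (by simpa using hδ₁)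
      (by rw [norm_sub_rev]; linarith)
    rw [rootShift_zero, rootShift_zero, hR0 _ (hZR j hj h), hR0 _ (hZR k hk h), sub_self,
      zero_div, add_zero, add_zero, zero_sub, norm_neg] at h1
    have h2 : 0 < ‖Z j h - Z k h‖ := norm_pos_iff.2 (sub_ne_zero.2 hne)
    nlinarith
  obtain ⟨δ₂, hδ₂, hself⟩ := exists_norm_rootShift_self_lt hgC hgC' hRc hR' hR0
    (η := κ * δ) (by positivity)
  obtain ⟨δ₃, hδ₃, hnear⟩ := exists_norm_perturbed_sub_lt hgC.continuous M
    (η := (δ / 2) ^ s) (by positivity)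
  refine ⟨min (min δ₁ δ₂) δ₃, by positivity, fun lam h0 hlam => ?_⟩
  have hl₁ : |lam| < δ₁ := by
    rw [abs_of_pos h0]; exact hlam.trans_le ((min_le_left _ _).trans (min_le_left _ _))
  have hl₂ : |lam| < δ₂ := by
    rw [abs_of_pos h0]; exact hlam.trans_le ((min_le_left _ _).trans (min_le_right _ _))
  have hl₃ : |lam| < δ₃ := by
    rw [abs_of_pos h0]; exact hlam.trans_le (min_le_right _ _)
  -- the displacement on the page at the angle `h`
  set D : ℝ → ℂ → ℂ := fun h => cutoffSum s δ (fun j => Z j h)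
    (fun j => rootShift g g' lam (Z j h) (Complex.exp (h * Complex.I))) with hD
  have hlipj : ∀ h, ∀ j < s, ∀ w w', ‖w - Z j h‖ ≤ δ → ‖w' - Z j h‖ ≤ δ →
      ‖rootShift g g' lam (Z j h) (Complex.exp (h * Complex.I)) w
        - rootShift g g' lam (Z j h) (Complex.exp (h * Complex.I)) w'‖ ≤ κ * ‖w - w'‖ :=
    fun h j hj w w' hw hw' =>
      hlip lam hl₁ _ _ (hZR j hj h) w w' (by linarith) (by linarith)
  have hselfj : ∀ h, ∀ j < s,
      ‖rootShift g g' lam (Z j h) (Complex.exp (h * Complex.I)) (Z j h)‖ ≤ κ * δ :=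
    fun h j hj => (hself lam hl₂ _ _ (hZR j hj h)).le
  have hDlip : ∀ h, LipschitzWith (1 / 2) (D h) := fun h =>
    lipschitzWith_cutoffSum hδ hκ0.le hsκ (hlipj h) (hselfj h)
  have hDle : ∀ h w, ‖D h w‖ ≤ δ / 2 := fun h =>
    norm_cutoffSum_le hδ hκ0.le hsκ (hlipj h) (hselfj h)
  have hDeq : ∀ h, ∀ j < s, ∀ w, ‖w - Z j h‖ ≤ δ / 2 →
      D h w = rootShift g g' lam (Z j h) (Complex.exp (h * Complex.I)) w :=
    fun h j hj w hw => cutoffSum_eq hδ (hsep h) hj hw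
  have hDper : ∀ h w, D (h + 2 * Real.pi) w = D h w := by
    intro h w
    have he : Complex.exp (((h + 2 * Real.pi : ℝ) : ℂ) * Complex.I)
        = Complex.exp (h * Complex.I) := by
      push_cast
      rw [add_mul, Complex.exp_add, Complex.exp_two_pi_mul_I, mul_one]
    simp only [hD, he]
    exact sum_strand_add_two_pi a b r ℓ hs (fun z => (cutoff δ ‖w - z‖ : ℂ)
      * rootShift g g' lam z (Complex.exp (h * Complex.I)) w) h
  have hDc : Continuous fun p : ℂ × ℝ => D p.2 p.1 := by
    have hZc : ∀ j, Continuous (Z j) := continuous_strand a b s r ℓ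
    have hgc := hgC.continuous
    have hgc' := hgC'.continuous
    have hχ := continuous_cutoff δ
    simp only [hD, cutoffSum, rootShift]
    refine continuous_finsetSum _ fun j hj => Continuous.mul (by fun_prop) (Continuous.add
      (by fun_prop) (Continuous.div (by fun_prop) (by fun_prop) fun p => ?_))
    exact hR' _ (hZR j (Finset.mem_range.1 hj) p.2)
  refine ⟨D, hDlip, hDc, hDper, fun h w hw => ?_, fun h w hwM h0 => ?_, fun h w j hj hwj => ?_⟩
  · refine cutoffSum_eq_zero hδ fun j hj => ?_
    have h1 := hZM j hj h
    have h2 := norm_sub_norm_le w (Z j h)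
    linarith
  · have hsmall := hnear lam hl₃ w _ hwM (hexp1 h)
    rw [h0, zero_sub, norm_neg] at hsmall
    obtain ⟨j, hj, hwj⟩ := exists_norm_sub_strand_le a b r ℓ hs (by positivity) hsmall
    refine ⟨j, hj, ?_⟩
    rw [hDeq h j hj w hwj, rootShift, h0, zero_div, add_zero, add_sub_cancel]
  · have hwk : ‖w - Z j h‖ ≤ δ / 2 := by
      rw [← hwj, sub_add_cancel_left, norm_neg]
      exact hDle _ _
    rw [hDeq h j hj w hwk, rootShift, ← add_assoc, add_sub_cancel, add_eq_left,
      div_eq_zero_iff] at hwj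
    exact hwj.resolve_right (hR' _ (hZR j hj h))

/-- For small stretching factors the nodal set of `f` on `S³` is isotopic to the lemniscate link. -/
theorem exists_ambientIsotopic {a b : ℝ} (ha : 0 < a) (hb : 0 < b) {s ℓ : ℕ} (r : ℕ)
    (hs : 0 < s) (hℓ : 0 < ℓ) (hsℓ : Nat.Coprime s ℓ) :
    ∃ ε : ℝ, 0 < ε ∧ ∀ lam : ℝ, 0 < lam → lam < ε →
      AmbientIsotopic (lemniscateLink (lam * a) (lam * b) s r ℓ)
        (nodalSet (semiholMap (lam * a) (lam * b) s r ℓ)) := by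
  obtain ⟨M, hM1, hM⟩ := exists_re_mul_semiholDeriv_pos a b r ℓ hs
  have hroot : ∀ w v, ‖v‖ ≤ 1 → semiholMap a b s r ℓ (w, v) = 0 → ‖w‖ < M := fun w v hv h0 => by
    by_contra hge
    have := hM w v hv (not_lt.1 hge)
    rw [h0, map_zero, mul_zero] at this
    exact lt_irrefl _ this
  obtain ⟨ε, hε, hdisp⟩ := exists_displacement ha hb r hs hℓ hsℓ hroot
  refine ⟨min ε (1 / (2 * (M + 1))), by positivity, fun lam h0 hlam => ?_⟩
  obtain ⟨D, hDlip, hDc, hDper, hD0, hDto, hDfrom⟩ := hdisp lam h0 (hlam.trans_le (min_le_left _ _))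
  have hl₄ : lam * (M + 1) < 1 / 2 := by
    have := hlam.trans_le (min_le_right _ _)
    rw [lt_div_iff₀ (by positivity)] at this
    linarith
  have hlamC : (lam : ℂ) ≠ 0 := by exact_mod_cast h0.ne'
  have hexp1 : ∀ h : ℝ, ‖Complex.exp (h * Complex.I)‖ = 1 := Complex.norm_exp_ofReal_mul_I
  set B : ℂ → ℂ → ℂ := fun u c => lam * D (Complex.arg c) (u / lam) with hB
  have hBc : ∀ u c, ‖c‖ = 1 →
      ContinuousWithinAt (fun x : ℂ × ℂ => B x.1 x.2) {x | ‖x.2‖ = 1} (u, c) := by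
    intro u c hc
    refine ContinuousAt.continuousWithinAt (continuousAt_const.mul ?_)
    refine continuousAt_comp_arg (ψ := fun p : ℂ × ℝ => D p.2 (p.1 / lam)) ?_
      (fun x h => hDper h _) u (norm_ne_zero_iff.1 (by rw [hc]; exact one_ne_zero))
    exact hDc.comp (by fun_prop : Continuous fun p : ℂ × ℝ => (p.1 / (lam : ℂ), p.2))
  have hBlip : ∀ c, ‖c‖ = 1 → LipschitzWith (1 / 2) fun u => B u c := by
    intro c _
    refine LipschitzWith.of_dist_le_mul fun x y => ?_
    have h := (hDlip (Complex.arg c)).dist_le_mul (x / lam) (y / lam)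
    rw [dist_eq_norm, dist_eq_norm, ← sub_div, norm_div, Complex.norm_real,
      Real.norm_of_nonneg h0.le] at h
    rw [dist_eq_norm, dist_eq_norm, hB]
    simp only
    rw [← mul_sub, norm_mul, Complex.norm_real, Real.norm_of_nonneg h0.le]
    calc _ ≤ lam * (((1 / 2 : ℝ≥0) : ℝ) * (‖x - y‖ / lam)) := by gcongr
      _ = _ := by field_simp
  have hB0 : ∀ u c, 1 / 2 ≤ ‖u‖ → B u c = 0 := by
    intro u c hu
    rw [hB]
    simp only
    rw [hD0, mul_zero]
    rw [norm_div, Complex.norm_real, Real.norm_of_nonneg h0.le, le_div_iff₀ h0]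
    linarith
  have hnodal : ∀ w v : ℂ, semiholMap (lam * a) (lam * b) s r ℓ (lam * w, v) = 0 ↔
      semiholMap a b s r ℓ (w, v) = 0 := by
    intro w v
    rw [semiholMap_smul, mul_eq_zero]
    exact or_iff_right (pow_ne_zero _ hlamC)
  refine AmbientIsotopic.symm (ambientIsotopic_of_pageMove hBc hBlip hB0 fun q => ?_)
  obtain ⟨⟨u, v⟩, hq⟩ := q
  obtain ⟨w, rfl⟩ : ∃ w, u = lam * w := ⟨u / lam, (mul_div_cancel₀ _ hlamC).symm⟩
  have hdiv : (lam : ℂ) * w / lam = w := mul_div_cancel_left₀ _ hlamC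
  have hnorm : ‖(lam : ℂ) * w‖ = lam * ‖w‖ := by
    rw [norm_mul, Complex.norm_real, Real.norm_of_nonneg h0.le]
  have hvle : ‖v‖ ≤ 1 := by
    have h : ‖(lam : ℂ) * w‖ ^ 2 + ‖v‖ ^ 2 = 1 := hq
    nlinarith [norm_nonneg v, sq_nonneg ‖(lam : ℂ) * w‖]
  have hveq : v = (√(1 - lam ^ 2 * ‖w‖ ^ 2) : ℂ) * (v / ‖v‖) := by
    have h := snd_eq_sqrt_mul hq
    simp only [hnorm, mul_pow] at h
    exact h
  constructor
  · intro hK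
    have hgw : semiholMap a b s r ℓ (w, v) = 0 := (hnodal w v).1 hK
    have hwM := hroot w v hvle hgw
    have hu : ‖(lam : ℂ) * w‖ < 1 := by
      rw [hnorm]; nlinarith
    have hv0 : v ≠ 0 := (norm_fst_lt_one_iff hq).1 hu
    set c : ℂ := v / ‖v‖ with hcdef
    have hc : ‖c‖ = 1 := norm_div_norm_self hv0
    rw [hveq, ← exp_arg_eq_self hc] at hgw
    obtain ⟨j, hj, hwj⟩ := hDto _ w hwM.le hgw
    have hBw : (lam : ℂ) * w + B (lam * w) c = lam * strand a b s r ℓ j (Complex.arg c) := by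
      rw [hB]
      simp only
      rw [hdiv, ← mul_add, hwj]
    obtain ⟨h, hh, hhc⟩ := exists_exp_eq hc
    obtain ⟨k, hk, hjk⟩ := exists_eq_strand a b r ℓ hs (z := strand a b s r ℓ j (Complex.arg c)) (h := h) (by
      rw [hhc]
      have := semiholMap_strand a b r ℓ hs hj (Complex.arg c)
      rwa [exp_arg_eq_self hc] at this)
    refine ⟨⟨_, pageMove_mem_S3 hBlip hB0 hq⟩, ⟨k, Finset.mem_range.2 hk, h, hh, ?_, ?_⟩, rfl⟩
    · rw [strand_smul, ← hjk]
      exact hBw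
    · rw [strand_smul, ← hjk, hhc, ← hBw]
      rfl
  · rintro ⟨p, ⟨j, hj, h, hh, hp1, hp2⟩, hpq⟩
    rw [Finset.mem_range] at hj
    rw [hpq, strand_smul] at hp1 hp2
    have hZlt : ‖(lam : ℂ) * strand a b s r ℓ j h‖ < 1 := by
      rw [norm_mul, Complex.norm_real, Real.norm_of_nonneg h0.le]
      nlinarith [hroot _ _ (hexp1 h).le (semiholMap_strand a b r ℓ hs hj h)]
    have hsq : 0 < √(1 - ‖(lam : ℂ) * strand a b s r ℓ j h‖ ^ 2) :=
      Real.sqrt_pos.2 (by nlinarith [norm_nonneg ((lam : ℂ) * strand a b s r ℓ j h)])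
    have hcexp : v / (‖v‖ : ℂ) = Complex.exp (h * Complex.I) := by
      have h1 := snd_pageMove_div_norm hBlip hB0 hq
      have h2 : ‖(√(1 - ‖(lam : ℂ) * strand a b s r ℓ j h‖ ^ 2) : ℂ)
          * Complex.exp (h * Complex.I)‖ = √(1 - ‖(lam : ℂ) * strand a b s r ℓ j h‖ ^ 2) := by
        rw [norm_mul _ (Complex.exp _), hexp1, mul_one, Complex.norm_real,
          Real.norm_of_nonneg hsq.le]
      rw [hp2, h2, mul_div_cancel_left₀ _ (by exact_mod_cast hsq.ne')] at h1
      exact h1.symm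
    set c : ℂ := v / ‖v‖ with hcdef
    have hc : ‖c‖ = 1 := by rw [hcexp, hexp1]
    obtain ⟨k, hk, hjk⟩ := exists_eq_strand a b r ℓ hs (z := strand a b s r ℓ j h) (h := Complex.arg c) (by
      rw [exp_arg_eq_self hc, hcexp]
      exact semiholMap_strand a b r ℓ hs hj h)
    refine (hnodal w v).2 ?_
    rw [hveq, ← exp_arg_eq_self hc]
    refine hDfrom _ w k hk (mul_left_cancel₀ hlamC ?_)
    rw [← hjk, mul_add]
    have : (lam : ℂ) * w + lam * D (Complex.arg c) (lam * w / lam) = lam * strand a b s r ℓ j h := hp1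
    rwa [hdiv] at this

end Lemniscate

end

theorem theorem4 (s r ℓ : ℕ) (hs : 0 < s) (hr : 0 < r) (hℓ : 0 < ℓ) (hsℓ : Nat.Coprime s ℓ)
    (a b : ℝ) (ha : 0 < a) (hb : 0 < b) :
    (∀ lam mu : ℝ, 0 < lam → 0 < mu →
      (Lemniscate.NoPhaseCritical (lam * a) (lam * b) s r ℓ ↔
        Lemniscate.NoPhaseCritical (mu * a) (mu * b) s r ℓ)) ∧
    ((∃ lam : ℝ, 0 < lam ∧ Lemniscate.NoPhaseCritical (lam * a) (lam * b) s r ℓ) →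
      ∃ ε : ℝ, 0 < ε ∧ ∀ lam : ℝ, 0 < lam → lam < ε →
        Lemniscate.AmbientIsotopic
          (Lemniscate.lemniscateLink (lam * a) (lam * b) s r ℓ)
          (Lemniscate.nodalSet (Lemniscate.semiholMap (lam * a) (lam * b) s r ℓ)) ∧
        (∀ q : ℂ × ℂ,
          ¬ Lemniscate.IsPhaseCriticalOnS3
            (Lemniscate.semiholMap (lam * a) (lam * b) s r ℓ) q) ∧
        Lemniscate.IsLocallyTrivialFibration
          (Lemniscate.phaseMap (Lemniscate.semiholMap (lam * a) (lam * b) s r ℓ))) := by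
  refine ⟨fun lam mu hlam hmu => Lemniscate.noPhaseCritical_smul_iff hlam hmu, ?_⟩
  rintro ⟨lam₀, hlam₀, hcrit₀⟩
  have hcrit : Lemniscate.NoPhaseCritical a b s r ℓ := by
    have := (Lemniscate.noPhaseCritical_smul_iff hlam₀ one_pos).1 hcrit₀
    rwa [one_mul, one_mul] at this
  obtain ⟨ε₁, hε₁, hiso⟩ := Lemniscate.exists_ambientIsotopic ha hb r hs hℓ hsℓ
  obtain ⟨ε₂, hε₂, hreg⟩ := hcrit.exists_isPhaseRegularOnS3 ha hb hs hℓ hsℓ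
  obtain ⟨M, hM1, hM⟩ := Lemniscate.exists_re_mul_semiholDeriv_pos a b r ℓ hs
  refine ⟨min (min ε₁ ε₂) (1 / M), by positivity, fun lam h0 hlam => ?_⟩
  have hreg' := hreg lam h0 (hlam.trans_le ((min_le_left _ _).trans (min_le_right _ _)))
  refine ⟨hiso lam h0 (hlam.trans_le ((min_le_left _ _).trans (min_le_left _ _))),
    hreg'.not_isPhaseCriticalOnS3
      ((Lemniscate.contDiff_semiholMap _ _ _ _ _ (m := 1)).differentiable one_ne_zero),
    hreg'.isLocallyTrivialFibration (Lemniscate.contDiff_semiholMap _ _ _ _ _)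
      ⟨(1, 0), by simp [Lemniscate.S3], ?_⟩⟩
  -- the point `(1, 0)` corresponds to `w = 1 / λ`, which is large
  have hlamC : (lam : ℂ) ≠ 0 := by exact_mod_cast h0.ne'
  have h1 := hM (1 / lam) 0 (by simp) (by
    rw [norm_div, norm_one, Complex.norm_real, Real.norm_of_nonneg h0.le, le_div_comm₀ (by linarith) h0]
    exact (hlam.trans_le (min_le_right _ _)).le)
  rw [show (1 : ℂ) = lam * (1 / lam) from (mul_div_cancel₀ _ hlamC).symm, Lemniscate.semiholMap_smul]
  refine mul_ne_zero (pow_ne_zero _ hlamC) fun h2 => ?_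
  rw [h2, map_zero, mul_zero] at h1
  exact lt_irrefl _ h1
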